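/- Let $a<b$, $T>0$, $K\in\mathbb R$, let $m_0\ge 2$ be an integer, and let $\sigma_1=\begin{pmatrix}0&1\\1&0\end{pmatrix}$, $\sigma_3=\begin{pmatrix}1&0\\0&-1\end{pmatrix}$. For $0<\varepsilon\le 1$ consider the Dirac equation on $(a,b)$ with real potentials $V,A_1$ and periodic boundary conditions, $$i\partial_t\Phi=\Bigl[-\tfrac{i}{\varepsilon}\sigma_1\partial_x+\tfrac1{\varepsilon^2}\sigma_3\Bigr]\Phi+G\,\Phi,\qquad G(t,x)=V(t,x)I_2-A_1(t,x)\sigma_1,$$ $$\Phi(t,a)=\Phi(t,b),\quad \partial_x\Phi(t,a)=\partial_x\Phi(t,b),\quad \Phi(0,x)=\Phi_0(x),$$ with $\Phi(t,x)\in\mathbb C^2$. Put $H^k_p=\{u\in H^k(a,b):\partial_x^lu(a)=\partial_x^lu(b),\ 0\le l\le k-1\}$. Assume that the solution $\Phi$ on $[0,T]$ satisfies (C) $\ \|\Phi\|_{L^\infty([0,T];(H^{m_0}_p)^2)}\le K$, $\ \|\partial_t\Phi\|_{L^\infty([0,T];(L^2)^2)}\le K\varepsilon^{-2}$, $\ \|\partial_{tt}\Phi\|_{L^\infty([0,T];(L^2)^2)}\le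 K\varepsilon^{-4}$, and that the potentials satisfy (D) $V,A_1\in W^{2,\infty}([0,T];L^\infty(a,b))$, where $V$, $A_1$ and their first and second time derivatives are bounded by $K$ in $L^\infty([0,T];L^\infty(a,b))$. *The scheme (EWI-FS).* Let $M$ be an even positive integer, $h=(b-a)/M$, $\tau>0$, $t_n=n\tau$, $\mu_l=\frac{2l\pi}{b-a}$, $\widehat U_l=\frac1{b-a}\int_a^bU(x)e^{-i\mu_l(x-a)}dx$, $\Gamma_l=\mu_l\varepsilon\sigma_1+\sigma_3$, and $$Q^{(1)}_l=-i\varepsilon^2\Gamma_l^{-1}\bigl[I_2-e^{-i\tau\Gamma_l/\varepsilon^2}\bigr],\qquad Q^{(2)}_l=-i\varepsilon^2\tau\Gamma_l^{-1}+\varepsilon^4\Gamma_l^{-2}\bigl[I_2-e^{-i\tau\Gamma_l/\varepsilon^2}\bigr].$$ Define $\Phi_M^n(x)=\sum_{l=-M/2}^{M/2-1}\widehat{(\Phi_M^n)}_l\,e^{i\mu_l(x-a)}$ by $\widehat{(\Phi_M^0)}_l=\widehat{(\Phi_0)}_l$ and, for $-M/2\le l\le M/2-1$, $$\widehat{(\Phi_M^{1})}_l=e^{-i\tau\Gamma_l/\varepsilon^2}\widehat{(\Phi_M^0)}_l-iQ^{(1)}_l\,\widehat{(G(0)\Phi_M^0)}_l,$$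 $$\widehat{(\Phi_M^{n+1})}_l=e^{-i\tau\Gamma_l/\varepsilon^2}\widehat{(\Phi_M^n)}_l-iQ^{(1)}_l\,\widehat{(G(t_n)\Phi_M^n)}_l-iQ^{(2)}_l\,\frac{\widehat{(G(t_n)\Phi_M^n)}_l-\widehat{(G(t_{n-1})\Phi_M^{n-1})}_l}{\tau},\qquad n\ge1.$$ **Theorem.** There are constants $h_0>0$, $\tau_0>0$ and $C>0$, depending only on $a,b,T,K,m_0$ (in particular not on $\varepsilon,h,\tau,n$), such that for every $0<\varepsilon\le1$, all $\Phi,V,A_1$ as above, and all $0<h\le h_0$ and $0<\tau\le\tau_0$ satisfying the stability condition $\tau\,(V_{\max}+A_{1,\max})\le1$, where $V_{\max}=\max_{t\in[0,T]}\|V(t)\|_{L^\infty}$ and $A_{1,\max}=\max_{t\in[0,T]}\|A_1(t)\|_{L^\infty}$, $$\|\Phi(t_n,\cdot)-\Phi_M^n\|_{L^2}\le C\Bigl(\frac{\tau^2}{\varepsilon^4}+h^{m_0}\Bigr),\qquad 0\le n\le \frac T\tau .$$ -/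

import Mathlib

open MeasureTheory Set
open scoped ENNReal ContDiff

namespace DiracEWI

noncomputable section

/-- Two-component spinors `ℂ²` with the Euclidean norm. -/
abbrev Spinor : Type := EuclideanSpace ℂ (Fin 2)

/-- The space `(L²(a,b))²`; its norm is `(∫_a^b |U(x)|² dx)^{1/2}`. -/
abbrev L2Spinor (a b : ℝ) : Type := Lp Spinor 2 (volume.restrict (Ioo a b))

/-- The space `L^∞(a,b)` of real-valued functions. -/
abbrev LInfReal (a b : ℝ) : Type := Lp ℝ ∞ (volume.restrict (Ioo a b))

/-! ### Sobolev spaces -/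

/-- `v` is the weak derivative of `u` on the interval `(s,t)`, tested against `C_c^∞(s,t)`.
It is used in space (values in `ℂ²`) and in time (values in a Banach space of functions).
Wherever it occurs below, `u` and `v` are also required to be integrable on `(s,t)`. -/
def HasWeakDerivOn {E : Type*} [NormedAddCommGroup E] [NormedSpace ℝ E]
    (s t : ℝ) (u v : ℝ → E) : Prop :=
  ∀ φ : ℝ → ℝ, ContDiff ℝ ∞ φ → HasCompactSupport φ → tsupport φ ⊆ Ioo s t →
    ∫ x in Ioo s t, deriv φ x • u x = -∫ x in Ioo s t, φ x • v x

/-- `u` takes the same boundary values (traces) at `a` and at `b`: it agrees almost everywhere on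
`(a,b)` with a function that is continuous on `[a,b]` and takes equal values at `a` and `b`. -/
def PeriodicTrace (a b : ℝ) (u : ℝ → Spinor) : Prop :=
  ∃ w : ℝ → Spinor, ContinuousOn w (Icc a b) ∧ u =ᵐ[volume.restrict (Ioo a b)] w ∧ w a = w b

/-- `u ∈ (H^m_p(a,b))²` and `‖u‖_{H^m} ≤ R`, where `H^m_p` is the space of those `u ∈ H^m(a,b)`
with `∂_x^l u(a) = ∂_x^l u(b)` for `l = 0, …, m-1`, and `‖u‖²_{H^m} = ∑_{l ≤ m} ‖∂_x^l u‖²_{L²}`.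
Here `D l` is the weak derivative `∂_x^l u`. -/
def HpNormLE (a b : ℝ) (m : ℕ) (u : ℝ → Spinor) (R : ℝ) : Prop :=
  ∃ D : ℕ → ℝ → Spinor, D 0 = u ∧
    (∀ l ≤ m, MemLp (D l) 2 (volume.restrict (Ioo a b))) ∧
    (∀ l < m, HasWeakDerivOn a b (D l) (D (l + 1))) ∧
    (∀ l < m, PeriodicTrace a b (D l)) ∧
    ∑ l ∈ Finset.range (m + 1), ∫ x in Ioo a b, ‖D l x‖ ^ 2 ≤ R ^ 2

/-- `u ∈ W^{2,∞}([0,T]; E)` (taken as its continuous representative), with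
first and second weak (Bochner) time derivatives `u₁` and `u₂`, and with
`‖u‖_{L^∞(0,T;E)} ≤ K₀`, `‖u₁‖_{L^∞(0,T;E)} ≤ K₁`, `‖u₂‖_{L^∞(0,T;E)} ≤ K₂`. -/
structure W2InfBound {E : Type*} [NormedAddCommGroup E] [NormedSpace ℝ E]
    (T : ℝ) (u u₁ u₂ : ℝ → E) (K₀ K₁ K₂ : ℝ) : Prop where
  continuousOn : ContinuousOn u (Icc 0 T)
  memLp₁ : MemLp u₁ ∞ (volume.restrict (Ioo 0 T))
  memLp₂ : MemLp u₂ ∞ (volume.restrict (Ioo 0 T))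
  weakDeriv₁ : HasWeakDerivOn 0 T u u₁
  weakDeriv₂ : HasWeakDerivOn 0 T u₁ u₂
  bound₀ : ∀ᵐ t ∂(volume.restrict (Ioo 0 T)), ‖u t‖ ≤ K₀
  bound₁ : ∀ᵐ t ∂(volume.restrict (Ioo 0 T)), ‖u₁ t‖ ≤ K₁
  bound₂ : ∀ᵐ t ∂(volume.restrict (Ioo 0 T)), ‖u₂ t‖ ≤ K₂

/-! ### The Dirac equation -/

/-- The Pauli matrix `σ₁`. -/
def pauli1 : Matrix (Fin 2) (Fin 2) ℂ := !![0, 1; 1, 0]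

/-- The Pauli matrix `σ₃`. -/
def pauli3 : Matrix (Fin 2) (Fin 2) ℂ := !![1, 0; 0, -1]

/-- The action `B u` of a `2 × 2` matrix on a spinor. -/
def act (B : Matrix (Fin 2) (Fin 2) ℂ) (u : Spinor) : Spinor :=
  Matrix.toEuclideanCLM (n := Fin 2) (𝕜 := ℂ) B u

/-- The value `G = V I₂ - A₁ σ₁` of the potential matrix, where `v`, `α` are the values of
`V`, `A₁`. -/
def potential (v α : ℝ) : Matrix (Fin 2) (Fin 2) ℂ :=
  (v : ℂ) • (1 : Matrix (Fin 2) (Fin 2) ℂ) - (α : ℂ) • pauli1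

/-- `Φ` solves, on `[0,T] × (a,b)`, the Dirac equation
`i ∂_t Φ = [-(i/ε) σ₁ ∂_x + (1/ε²) σ₃] Φ + [V I₂ - A₁ σ₁] Φ`
with periodic boundary conditions for `Φ` and `∂_x Φ` and with initial value `Φ₀`.
Here `Φt` is the time derivative of `Φ` and the equation holds in `L²` for almost every `t`. -/
structure IsDiracSolution (ε a b T : ℝ) (V A : ℝ → LInfReal a b) (Φ₀ : L2Spinor a b)
    (Φ Φt : ℝ → L2Spinor a b) : Prop where
  initial : Φ 0 = Φ₀
  equation : ∀ᵐ t ∂(volume.restrict (Ioo 0 T)), ∃ Φx : ℝ → Spinor,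
    MemLp Φx 2 (volume.restrict (Ioo a b)) ∧
    HasWeakDerivOn a b (Φ t) Φx ∧
    PeriodicTrace a b (Φ t) ∧ PeriodicTrace a b Φx ∧
    ∀ᵐ x ∂(volume.restrict (Ioo a b)),
      Complex.I • Φt t x =
        (-(Complex.I / (ε : ℂ))) • act pauli1 (Φx x)
          + (1 / (ε : ℂ) ^ 2) • act pauli3 (Φ t x)
          + act (potential (V t x) (A t x)) (Φ t x)

/-! ### The exponential wave integrator Fourier spectral scheme -/

/-- The frequencies `μ_l = 2 l π / (b - a)`. -/
def freq (a b : ℝ) (l : ℤ) : ℝ := 2 * (l : ℝ) * Real.pi / (b - a)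

/-- The Fourier coefficient `Û_l = (b-a)⁻¹ ∫_a^b U(x) e^{-i μ_l (x-a)} dx`. -/
def coeff (a b : ℝ) (U : ℝ → Spinor) (l : ℤ) : Spinor :=
  (1 / (b - a) : ℝ) •
    ∫ x in Ioo a b, Complex.exp (-(Complex.I * (freq a b l : ℂ) * ((x - a : ℝ) : ℂ))) • U x

/-- The trigonometric polynomial `∑_{l=-M/2}^{M/2-1} c_l e^{i μ_l (x-a)}`, for `M` even. -/
def trigPoly (a b : ℝ) (M : ℕ) (c : ℤ → Spinor) (x : ℝ) : Spinor :=
  ∑ l ∈ Finset.Ico (-((M : ℤ) / 2)) ((M : ℤ) / 2),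
    Complex.exp (Complex.I * (freq a b l : ℂ) * ((x - a : ℝ) : ℂ)) • c l

/-- `Γ_l = μ_l ε σ₁ + σ₃`. -/
def Gam (ε a b : ℝ) (l : ℤ) : Matrix (Fin 2) (Fin 2) ℂ :=
  ((freq a b l * ε : ℝ) : ℂ) • pauli1 + pauli3

/-- `e^{-i τ Γ_l / ε²}`. -/
def expGam (ε a b τ : ℝ) (l : ℤ) : Matrix (Fin 2) (Fin 2) ℂ :=
  NormedSpace.exp ((-(Complex.I * (τ : ℂ) / (ε : ℂ) ^ 2)) • Gam ε a b l)

/-- `Q_l^{(1)}(τ) = -i ε² Γ_l⁻¹ [I₂ - e^{-i τ Γ_l / ε²}]`. -/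
def Q1 (ε a b τ : ℝ) (l : ℤ) : Matrix (Fin 2) (Fin 2) ℂ :=
  (-(Complex.I * (ε : ℂ) ^ 2)) • ((Gam ε a b l)⁻¹ * (1 - expGam ε a b τ l))

/-- `Q_l^{(2)}(τ) = -i ε² τ Γ_l⁻¹ + ε⁴ Γ_l⁻² [I₂ - e^{-i τ Γ_l / ε²}]`. -/
def Q2 (ε a b τ : ℝ) (l : ℤ) : Matrix (Fin 2) (Fin 2) ℂ :=
  (-(Complex.I * (ε : ℂ) ^ 2 * (τ : ℂ))) • (Gam ε a b l)⁻¹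
    + ((ε : ℂ) ^ 4) • (((Gam ε a b l)⁻¹) ^ 2 * (1 - expGam ε a b τ l))

/-- The Fourier coefficient of `G(t) U`, where `G(t,x) = V(t,x) I₂ - A₁(t,x) σ₁`. -/
def forceCoeff (a b : ℝ) (V A : ℝ → ℝ → ℝ) (t : ℝ) (U : ℝ → Spinor) (l : ℤ) : Spinor :=
  coeff a b (fun x => act (potential (V t x) (A t x)) (U x)) l

/-- The numerical solution `Φ_M^n` of the EWI-FS scheme, with `t_n = n τ`:
`Φ_M^0 = P_M Φ₀`; the first step uses the left-endpoint Gautschi rule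
`-i Q_l^{(1)} (G(t_0) Φ_M^0)^_l`, and the later steps use
`-i Q_l^{(1)} (G(t_n) Φ_M^n)^_l - i Q_l^{(2)} δ_t^- (G(t_n) Φ_M^n)^_l`. -/
def ewiFS (ε a b τ : ℝ) (M : ℕ) (V A : ℝ → ℝ → ℝ) (Φ₀ : ℝ → Spinor) : ℕ → ℝ → Spinor
  | 0 => trigPoly a b M (coeff a b Φ₀)
  | 1 => trigPoly a b M fun l =>
      act (expGam ε a b τ l) (coeff a b (ewiFS ε a b τ M V A Φ₀ 0) l)
        - Complex.I • act (Q1 ε a b τ l)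
            (forceCoeff a b V A 0 (ewiFS ε a b τ M V A Φ₀ 0) l)
  | (n + 2) => trigPoly a b M fun l =>
      act (expGam ε a b τ l) (coeff a b (ewiFS ε a b τ M V A Φ₀ (n + 1)) l)
        - Complex.I • act (Q1 ε a b τ l)
            (forceCoeff a b V A (((n + 1 : ℕ) : ℝ) * τ) (ewiFS ε a b τ M V A Φ₀ (n + 1)) l)
        - Complex.I • act (Q2 ε a b τ l)
            ((1 / τ : ℝ) •
              (forceCoeff a b V A (((n + 1 : ℕ) : ℝ) * τ) (ewiFS ε a b τ M V A Φ₀ (n + 1)) l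
                - forceCoeff a b V A ((n : ℝ) * τ) (ewiFS ε a b τ M V A Φ₀ n) l))

/-- `max_{t ∈ [0,T]} ‖V(t)‖_{L^∞}`. -/
def maxNorm {a b : ℝ} (T : ℝ) (V : ℝ → LInfReal a b) : ℝ :=
  sSup ((fun t => ‖V t‖) '' Icc 0 T)

end

end DiracEWI

/-!
Everything is done in `L²(a,b)`, one Fourier mode at a time.

*Regularity.* By du Bois-Reymond's lemma (`HasWeakDerivOn.ae_eq_primitive`) a function with an
integrable weak derivative is a primitive of it. In time, this makes `Φ`, `V` and `A₁` functions of
class `C^{1,1}` on `[0,T]` (`W2InfBound.exists_isC11On`), and so is the force `F = G Φ`, by the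
product rule (`IsC11On.force`), with constants `O(ε⁻²)` for `F'` and `O(ε⁻⁴)` for the Lipschitz
constant of `F'`. In space, integration by parts against `e^{-iμ_l(x-a)}`, whose boundary terms
cancel by periodicity, gives `(∂_x u)^_l = iμ_l û_l` (`coeff_weakDeriv`). With Parseval's identity
this bounds the projection error of `Φ(t)` by `K h^{m₀}`, first for almost every `t` and then, by
continuity, for all `t`.

*One step.* The coefficients of `Φ` solve `c_l' = X_l c_l - i F̂_l` with `X_l = -(i/ε²) Γ_l`
(`IsDiracSolution.hasDerivWithinAt_coeff`). As a function of the step length, the update of the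
scheme solves the same equation with `F` replaced by the affine function of time that the scheme
extrapolates from its last two values (`hasDerivAt_ewiCoeff`). The difference of the two, turned
back by the unitary matrices `e^{-sX_l}`, has derivative of `L²` norm at most the distance between
the two forces, so the mean value inequality (`norm_trigL2_sub_ewiCoeff_le`) bounds the growth of
the error over a step by `τ` times that distance. No bound on `Q^{(1)}_l` or `Q^{(2)}_l` is needed.

*Accumulation.* The distance between the forces is `O(τ²/ε⁴)`, by Taylor's formula
(`norm_sub_extrapolation_le`), plus `O(K)` times the errors at the last two time levels; in the
first step, which extrapolates by a constant, it is `O(τ/ε²)`, and this enters only once.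
A discrete Gronwall inequality (`two_step_gronwall`) gives the result.
-/

namespace DiracEWI

/-! ### Weak derivatives on an interval -/

section WeakDerivatives

theorem _root_.Continuous.integrableOn_smul_Ioo {𝕜 E : Type*} [RCLike 𝕜]
    [NormedAddCommGroup E] [NormedSpace 𝕜 E] {s t : ℝ} {φ : ℝ → 𝕜} {w : ℝ → E} (hφ : Continuous φ)
    (hw : IntegrableOn w (Ioo s t)) :
    IntegrableOn (fun x => φ x • w x) (Ioo s t) := by
  obtain ⟨B, hB⟩ := (isCompact_Icc (a := s) (b := t)).exists_bound_of_continuousOn hφ.continuousOn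
  refine Integrable.bdd_smul hw B hφ.aestronglyMeasurable ?_
  exact (ae_restrict_iff' measurableSet_Ioo).2
    (Filter.Eventually.of_forall fun x hx => hB x (Ioo_subset_Icc_self hx))

variable {E : Type*} [NormedAddCommGroup E] [NormedSpace ℝ E]

/-- Integration by parts against the primitive of a function that is merely integrable; the proof
is Fubini's theorem on the triangle `y ≤ x`. -/
theorem integral_deriv_smul_primitive [CompleteSpace E] {𝕜 : Type*} [RCLike 𝕜] [NormedSpace 𝕜 E]
    {s t : ℝ} (hst : s ≤ t)
    {φ φ' : ℝ → 𝕜} (hφ : ∀ x, HasDerivAt φ (φ' x) x) (hφ' : Continuous φ')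
    {v : ℝ → E} (hv : IntegrableOn v (Ioo s t)) :
    ∫ x in Ioo s t, φ' x • (∫ y in s..x, v y)
      = φ t • (∫ y in s..t, v y) - ∫ x in Ioo s t, φ x • v x := by
  have hφc : Continuous φ := continuous_iff_continuousAt.2 fun x => (hφ x).continuousAt
  have hφ'i : IntegrableOn φ' (Ioo s t) :=
    (hφ'.integrableOn_Icc (a := s) (b := t)).mono_set Ioo_subset_Icc_self
  have hφv : IntegrableOn (fun x => φ x • v x) (Ioo s t) := hφc.integrableOn_smul_Ioo hv
  let k : ℝ → ℝ → E := fun x y => {p : ℝ × ℝ | p.2 ≤ p.1}.indicator (fun p => φ' p.1 • v p.2) (x, y)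
  have hk : Integrable (Function.uncurry k)
      ((volume.restrict (Ioo s t)).prod (volume.restrict (Ioo s t))) := by
    refine (Integrable.smul_prod hφ'i hv).indicator ?_
    exact measurableSet_le measurable_snd measurable_fst
  have h1 : ∀ x ∈ Ioo s t, ∫ y in Ioo s t, k x y = φ' x • (∫ y in s..x, v y) := by
    intro x hx
    have : ∀ y, k x y = (Iic x).indicator (fun y => φ' x • v y) y := by
      intro y; simp [k, indicator_apply]
    simp_rw [this]
    rw [setIntegral_indicator measurableSet_Iic, intervalIntegral.integral_of_le hx.1.le,
      ← integral_smul]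
    congr 2
    ext y
    simp only [mem_inter_iff, mem_Ioo, mem_Iic, mem_Ioc]
    exact ⟨fun h => ⟨h.1.1, h.2⟩, fun h => ⟨⟨h.1, h.2.trans_lt hx.2⟩, h.2⟩⟩
  have h2 : ∀ y ∈ Ioo s t, ∫ x in Ioo s t, k x y = φ t • v y - φ y • v y := by
    intro y hy
    have : ∀ x, k x y = (Ici y).indicator (fun x => φ' x • v y) x := by
      intro x; simp [k, indicator_apply]
    simp_rw [this]
    rw [setIntegral_indicator measurableSet_Ici, integral_smul_const, ← sub_smul]
    congr 1
    have e : Ioo s t ∩ Ici y = Ico y t := by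
      ext x
      simp only [mem_inter_iff, mem_Ioo, mem_Ici, mem_Ico]
      exact ⟨fun h => ⟨h.2, h.1.2⟩, fun h => ⟨⟨hy.1.trans_le h.1, h.2⟩, h.1⟩⟩
    rw [e, integral_Ico_eq_integral_Ioc, ← intervalIntegral.integral_of_le hy.2.le]
    exact intervalIntegral.integral_eq_sub_of_hasDerivAt (fun x _ => hφ x)
      (hφ'.intervalIntegrable _ _)
  rw [← setIntegral_congr_fun measurableSet_Ioo h1, integral_integral_swap hk,
    setIntegral_congr_fun measurableSet_Ioo h2,
    integral_sub (continuous_const.integrableOn_smul_Ioo hv) hφv, integral_smul,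
    intervalIntegral.integral_of_le hst, integral_Ioc_eq_integral_Ioo]

theorem exists_Icc_of_isCompact_subset_Ioo {s t : ℝ} (hst : s < t) {S : Set ℝ}
    (hS : IsCompact S) (hSs : S ⊆ Ioo s t) : ∃ p q, s < p ∧ p ≤ q ∧ q < t ∧ S ⊆ Icc p q := by
  rcases S.eq_empty_or_nonempty with rfl | hne
  · exact ⟨(s + t) / 2, (s + t) / 2, by linarith, le_rfl, by linarith, empty_subset _⟩
  · obtain ⟨p, hp, hp'⟩ := hS.exists_isLeast hne
    obtain ⟨q, hq, hq'⟩ := hS.exists_isGreatest hne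
    exact ⟨p, q, (hSs hp).1, hp' hq, (hSs hq).2, fun x hx => ⟨hp' hx, hq' hx⟩⟩

/-- A test function with integral zero is the derivative of a test function. -/
theorem exists_testFunction_deriv_eq {s t : ℝ} (hst : s < t) {χ : ℝ → ℝ} (hχ : ContDiff ℝ ∞ χ)
    (hc : HasCompactSupport χ) (hs : tsupport χ ⊆ Ioo s t) (h0 : ∫ x, χ x = 0) :
    ∃ φ : ℝ → ℝ, ContDiff ℝ ∞ φ ∧ HasCompactSupport φ ∧ tsupport φ ⊆ Ioo s t ∧ deriv φ = χ := by
  obtain ⟨p, q, hp, hpq, hq, hS⟩ := exists_Icc_of_isCompact_subset_Ioo hst hc hs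
  have hz : ∀ x, x ∉ Icc p q → χ x = 0 := fun x hx =>
    image_eq_zero_of_notMem_tsupport fun h => hx (hS h)
  have hd : ∀ x, HasDerivAt (fun x => ∫ y in p..x, χ y) (χ x) x := fun x =>
    intervalIntegral.integral_hasDerivAt_right (hχ.continuous.intervalIntegrable _ _)
      hχ.continuous.stronglyMeasurable.stronglyMeasurableAtFilter hχ.continuous.continuousAt
  have hder : deriv (fun x => ∫ y in p..x, χ y) = χ := funext fun x => (hd x).deriv
  have hsupp : tsupport (fun x => ∫ y in p..x, χ y) ⊆ Icc p q := by
    refine closure_minimal ?_ isClosed_Icc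
    intro x hx
    by_contra hn
    apply hx
    show ∫ y in p..x, χ y = 0
    rw [mem_Icc, not_and_or, not_le, not_le] at hn
    rcases hn with hn | hn
    · rw [intervalIntegral.integral_symm, intervalIntegral.integral_of_le hn.le,
        integral_Ioc_eq_integral_Ioo,
        setIntegral_eq_zero_of_forall_eq_zero fun y hy => hz y fun h => (h.1.trans_lt hy.2).false,
        neg_zero]
    · rw [intervalIntegral.integral_of_le (hpq.trans hn.le), ← integral_Icc_eq_integral_Ioc,
        setIntegral_eq_integral_of_forall_compl_eq_zero, h0]
      exact fun y hy => hz y fun h => hy ⟨h.1, h.2.trans hn.le⟩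
  refine ⟨_, ?_, ?_, hsupp.trans fun x hx => ⟨hp.trans_le hx.1, hx.2.trans_lt hq⟩, hder⟩
  · rw [contDiff_infty_iff_deriv, hder]
    exact ⟨fun x => (hd x).differentiableAt, hχ⟩
  · exact HasCompactSupport.of_support_subset_isCompact isCompact_Icc
      ((subset_tsupport _).trans hsupp)

/-- Du Bois-Reymond's lemma: up to an additive constant, a function is the primitive of its
weak derivative. -/
theorem HasWeakDerivOn.ae_eq_primitive [CompleteSpace E] {s t : ℝ} (hst : s < t) {u v : ℝ → E}
    (h : HasWeakDerivOn s t u v) (hu : IntegrableOn u (Ioo s t)) (hv : IntegrableOn v (Ioo s t)) :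
    ∃ c : E, u =ᵐ[volume.restrict (Ioo s t)] fun x => c + ∫ y in s..x, v y := by
  have hvI : IntervalIntegrable v volume s t :=
    (intervalIntegrable_iff_integrableOn_Ioo_of_le hst.le).2 hv
  have hWc : ContinuousOn (fun x => ∫ y in s..x, v y) (Icc s t) := by
    have := intervalIntegral.continuousOn_primitive_interval' hvI left_mem_uIcc
    rwa [uIcc_of_le hst.le] at this
  have hW : IntegrableOn (fun x => ∫ y in s..x, v y) (Ioo s t) :=
    hWc.integrableOn_Icc.mono_set Ioo_subset_Icc_self
  set g : ℝ → E := fun x => u x - ∫ y in s..x, v y with hg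
  have hgi : IntegrableOn g (Ioo s t) := hu.sub hW
  have key : ∀ φ : ℝ → ℝ, ContDiff ℝ ∞ φ → HasCompactSupport φ → tsupport φ ⊆ Ioo s t →
      ∫ x in Ioo s t, deriv φ x • g x = 0 := by
    intro φ h1 h2 h3
    have hcd : Continuous (deriv φ) := h1.continuous_deriv (by simp)
    have e := integral_deriv_smul_primitive (𝕜 := ℝ) hst.le
      (fun x => (h1.differentiable (by simp) x).hasDerivAt) hcd hv
    have ht : φ t = 0 := image_eq_zero_of_notMem_tsupport fun h => (h3 h).2.false
    simp_rw [hg, smul_sub]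
    rw [integral_sub (hcd.integrableOn_smul_Ioo hu) (hcd.integrableOn_smul_Ioo hW),
      h φ h1 h2 h3, e, ht]
    simp
  -- `ψ₀` corrects the integral of a test function to zero, so that it becomes a derivative.
  obtain ⟨ψ₀, hψ₀, hc₀, hs₀, hi₀⟩ : ∃ ψ₀ : ℝ → ℝ, ContDiff ℝ ∞ ψ₀ ∧ HasCompactSupport ψ₀ ∧
      tsupport ψ₀ ⊆ Ioo s t ∧ ∫ x, ψ₀ x = 1 := by
    let f : ContDiffBump ((s + t) / 2) := ⟨(t - s) / 4, (t - s) / 3, by linarith, by linarith⟩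
    refine ⟨f.normed volume, f.contDiff_normed, f.hasCompactSupport_normed, ?_, f.integral_normed⟩
    rw [f.tsupport_normed_eq]
    intro x hx
    rw [Metric.mem_closedBall, Real.dist_eq, abs_le] at hx
    simp only [f] at hx
    constructor <;> linarith [hx.1, hx.2]
  refine ⟨∫ x in Ioo s t, ψ₀ x • g x, ?_⟩
  set c := ∫ x in Ioo s t, ψ₀ x • g x with hc
  have main : ∀ᵐ x ∂(volume : Measure ℝ), x ∈ Ioo s t → g x - c = 0 := by
    refine isOpen_Ioo.ae_eq_zero_of_integral_contDiff_smul_eq_zero ?_ ?_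
    · exact (hgi.sub (integrableOn_const (by simp))).locallyIntegrableOn
    · intro ψ h1 h2 h3
      set m := ∫ x, ψ x with hm
      have hint : ∀ {ψ : ℝ → ℝ}, Continuous ψ → HasCompactSupport ψ → Integrable ψ :=
        fun h h' => h.integrable_of_hasCompactSupport h'
      have hts : tsupport (fun x => ψ x - m * ψ₀ x) ⊆ tsupport ψ ∪ tsupport ψ₀ := by
        refine closure_minimal ?_ ((isClosed_tsupport _).union (isClosed_tsupport _))
        intro x hx
        by_contra hn
        rw [mem_union, not_or] at hn
        exact hx (by simp [image_eq_zero_of_notMem_tsupport hn.1,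
          image_eq_zero_of_notMem_tsupport hn.2])
      obtain ⟨φ, f1, f2, f3, f4⟩ := exists_testFunction_deriv_eq hst
        (χ := fun x => ψ x - m * ψ₀ x) (h1.sub (contDiff_const.mul hψ₀))
        (HasCompactSupport.of_support_subset_isCompact (h2.isCompact.union hc₀.isCompact)
          ((subset_tsupport _).trans hts)) (hts.trans (union_subset h3 hs₀))
        (by rw [integral_sub (hint h1.continuous h2) ((hint hψ₀.continuous hc₀).const_mul _),
              integral_const_mul, hi₀, ← hm]; ring)
      have e := key φ f1 f2 f3
      rw [f4] at e
      simp_rw [sub_smul, mul_smul] at e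
      rw [integral_sub (h1.continuous.integrableOn_smul_Ioo hgi)
          (continuous_const.integrableOn_smul_Ioo (hψ₀.continuous.integrableOn_smul_Ioo hgi)),
        integral_smul, ← hc, sub_eq_zero] at e
      have e0 : ∫ x, ψ x • (g x - c) = ∫ x in Ioo s t, ψ x • (g x - c) := by
        rw [setIntegral_eq_integral_of_forall_compl_eq_zero]
        intro x hx
        rw [image_eq_zero_of_notMem_tsupport fun h => hx (h3 h), zero_smul]
      have e1 : m = ∫ x in Ioo s t, ψ x := by
        rw [setIntegral_eq_integral_of_forall_compl_eq_zero]
        intro x hx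
        rw [image_eq_zero_of_notMem_tsupport fun h => hx (h3 h)]
      rw [e0]
      simp_rw [smul_sub]
      rw [integral_sub (h1.continuous.integrableOn_smul_Ioo hgi)
        (h1.continuous.integrableOn_smul_Ioo (integrableOn_const (by simp))),
        integral_smul_const, ← e1, e, sub_self]
  rw [Filter.EventuallyEq, ae_restrict_iff' measurableSet_Ioo]
  filter_upwards [main] with x hx hx'
  have e := hx hx'
  rw [sub_eq_zero] at e
  rw [← e]
  simp [hg]

theorem eqOn_Icc_of_ae_eq {F : Type*} [TopologicalSpace F] [T2Space F] {s t : ℝ} (hst : s < t)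
    {f g : ℝ → F}
    (hf : ContinuousOn f (Icc s t)) (hg : ContinuousOn g (Icc s t))
    (h : f =ᵐ[volume.restrict (Ioo s t)] g) : EqOn f g (Icc s t) := by
  refine Measure.eqOn_Icc_of_ae_eq volume hst.ne ?_ hf hg
  rwa [Measure.restrict_congr_set Ioo_ae_eq_Icc.symm]

theorem le_on_Icc_of_ae_le {s t : ℝ} (hst : s < t) {g : ℝ → ℝ} {B : ℝ}
    (hg : ContinuousOn g (Icc s t)) (h : ∀ᵐ x ∂(volume.restrict (Ioo s t)), g x ≤ B) :
    ∀ x ∈ Icc s t, g x ≤ B := fun x hx =>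
  max_eq_right_iff.1 <| eqOn_Icc_of_ae_eq hst (f := fun x => max (g x) B) (g := fun _ => B)
    (hg.sup continuousOn_const) continuousOn_const
    (by filter_upwards [h] with x hx using max_eq_right hx) hx

/-- `u` is differentiable on `[0,T]` (one-sidedly at the endpoints) with derivative `v`, where `u`
and `v` are bounded by `K₀` and `K₁` and `v` is `K₂`-Lipschitz. This is the classical counterpart of
`W2InfBound`. -/
structure IsC11On (T : ℝ) (u v : ℝ → E) (K₀ K₁ K₂ : ℝ) : Prop where
  hasDeriv : ∀ t ∈ Icc 0 T, HasDerivWithinAt u (v t) (Icc 0 T) t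
  bound₀ : ∀ t ∈ Icc 0 T, ‖u t‖ ≤ K₀
  bound₁ : ∀ t ∈ Icc 0 T, ‖v t‖ ≤ K₁
  lipschitz : ∀ s ∈ Icc 0 T, ∀ t ∈ Icc 0 T, ‖v t - v s‖ ≤ K₂ * |t - s|

theorem W2InfBound.exists_isC11On [CompleteSpace E] {T : ℝ} (hT : 0 < T) {u u₁ u₂ : ℝ → E}
    {K₀ K₁ K₂ : ℝ} (h : W2InfBound T u u₁ u₂ K₀ K₁ K₂) :
    ∃ v : ℝ → E, IsC11On T u v K₀ K₁ K₂ ∧ u₁ =ᵐ[volume.restrict (Ioo 0 T)] v := by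
  have hu : IntegrableOn u (Ioo 0 T) :=
    h.continuousOn.integrableOn_Icc.mono_set Ioo_subset_Icc_self
  have hu₁ : IntegrableOn u₁ (Ioo 0 T) := h.memLp₁.integrable (by simp)
  have hu₂ : IntegrableOn u₂ (Ioo 0 T) := h.memLp₂.integrable (by simp)
  have hi : Integrable ((Ioo 0 T).indicator u₂) := hu₂.integrable_indicator measurableSet_Ioo
  obtain ⟨c, hc⟩ := h.weakDeriv₂.ae_eq_primitive hT hu₁ hu₂
  obtain ⟨d, hd⟩ := h.weakDeriv₁.ae_eq_primitive hT hu hu₁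
  set v : ℝ → E := fun x => c + ∫ y in (0 : ℝ)..x, (Ioo 0 T).indicator u₂ y with hv
  have hvc : Continuous v := continuous_const.add
    (intervalIntegral.continuous_primitive (fun _ _ => hi.intervalIntegrable) 0)
  have hv₁ : u₁ =ᵐ[volume.restrict (Ioo 0 T)] v := by
    filter_upwards [hc, ae_restrict_mem measurableSet_Ioo] with x hx hxT
    rw [hx, hv]
    congr 1
    rw [intervalIntegral.integral_of_le hxT.1.le, intervalIntegral.integral_of_le hxT.1.le]
    exact setIntegral_congr_fun measurableSet_Ioc fun y hy =>
      (indicator_of_mem (show y ∈ Ioo 0 T from ⟨hy.1, hy.2.trans_lt hxT.2⟩) u₂).symm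
  have hder : ∀ t, HasDerivAt (fun x => d + ∫ y in (0 : ℝ)..x, v y) (v t) t := fun t =>
    (intervalIntegral.integral_hasDerivAt_right (hvc.intervalIntegrable _ _)
      hvc.stronglyMeasurable.stronglyMeasurableAtFilter hvc.continuousAt).const_add d
  have huv : EqOn u (fun x => d + ∫ y in (0 : ℝ)..x, v y) (Icc 0 T) := by
    refine eqOn_Icc_of_ae_eq hT h.continuousOn
      (fun t _ => (hder t).continuousAt.continuousWithinAt) ?_
    filter_upwards [hd, ae_restrict_mem measurableSet_Ioo] with x hx hxT
    rw [hx]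
    congr 1
    refine intervalIntegral.integral_congr_ae ?_
    filter_upwards [(ae_restrict_iff' measurableSet_Ioo).1 hv₁] with y hy hy'
    rw [uIoc_of_le hxT.1.le] at hy'
    exact hy ⟨hy'.1, hy'.2.trans_lt hxT.2⟩
  refine ⟨v, ⟨fun t ht => (hder t).hasDerivWithinAt.congr huv (huv ht), ?_, ?_, ?_⟩, hv₁⟩
  · exact le_on_Icc_of_ae_le hT h.continuousOn.norm h.bound₀
  · refine le_on_Icc_of_ae_le hT hvc.norm.continuousOn ?_
    filter_upwards [h.bound₁, hv₁] with t h1 h2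
    rwa [← h2]
  · intro s _ t _
    have e : v t - v s = ∫ y in s..t, (Ioo 0 T).indicator u₂ y := by
      rw [hv]
      simp only [add_sub_add_left_eq_sub]
      exact intervalIntegral.integral_interval_sub_left hi.intervalIntegrable hi.intervalIntegrable
    have hK₂ : 0 ≤ K₂ := by
      have : Filter.NeBot (ae (volume.restrict (Ioo (0 : ℝ) T))) := by
        rw [ae_neBot, Ne, Measure.restrict_eq_zero]
        simpa using hT
      obtain ⟨x, hx⟩ := h.bound₂.exists
      exact (norm_nonneg _).trans hx
    rw [e]
    refine intervalIntegral.norm_integral_le_of_norm_le_const_ae ?_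
    filter_upwards [(ae_restrict_iff' measurableSet_Ioo).1 h.bound₂] with x hx _
    by_cases hxT : x ∈ Ioo 0 T
    · rw [indicator_of_mem hxT]; exact hx hxT
    · rw [indicator_of_notMem hxT, norm_zero]; exact hK₂

end WeakDerivatives

/-! ### Fourier coefficients and trigonometric polynomials in `L²` -/

section Fourier

variable {a b : ℝ}

theorem coeff_congr_ae {U W : ℝ → Spinor} (h : U =ᵐ[volume.restrict (Ioo a b)] W) (l : ℤ) :
    coeff a b U l = coeff a b W l := by
  unfold coeff
  congr 1
  refine integral_congr_ae ?_
  filter_upwards [h] with x hx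
  rw [hx]

theorem continuous_phase (l : ℤ) :
    Continuous fun x : ℝ => Complex.exp (-(Complex.I * (freq a b l : ℂ) * ((x - a : ℝ) : ℂ))) := by
  fun_prop

theorem coeff_add {U W : ℝ → Spinor} (hU : IntegrableOn U (Ioo a b))
    (hW : IntegrableOn W (Ioo a b)) (l : ℤ) :
    coeff a b (U + W) l = coeff a b U l + coeff a b W l := by
  unfold coeff
  simp_rw [Pi.add_apply, smul_add]
  rw [integral_add ((continuous_phase l).integrableOn_smul_Ioo hU)
    ((continuous_phase l).integrableOn_smul_Ioo hW), smul_add]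

theorem coeff_smul (r : ℝ) (U : ℝ → Spinor) (l : ℤ) :
    coeff a b (r • U) l = r • coeff a b U l := by
  unfold coeff
  simp_rw [Pi.smul_apply, smul_comm _ r]
  rw [integral_smul, smul_comm]

theorem coeff_act {U : ℝ → Spinor} (hU : IntegrableOn U (Ioo a b))
    (B : Matrix (Fin 2) (Fin 2) ℂ) (l : ℤ) :
    coeff a b (fun x => act B (U x)) l = act B (coeff a b U l) := by
  unfold coeff act
  rw [ContinuousLinearMap.map_smul_of_tower,
    ← ContinuousLinearMap.integral_comp_comm _ ((continuous_phase l).integrableOn_smul_Ioo hU)]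
  simp_rw [map_smul]

theorem coeff_apply (hab : a < b) {U : ℝ → Spinor} (hU : IntegrableOn U (Ioo a b)) (l : ℤ)
    (j : Fin 2) :
    coeff a b U l j = Complex.exp (Complex.I * freq a b l * a)
      * fourierCoeffOn hab (fun x => U x j) l := by
  have e : coeff a b U l j = (EuclideanSpace.proj j : Spinor →L[ℂ] ℂ) (coeff a b U l) := rfl
  rw [e, coeff, ContinuousLinearMap.map_smul_of_tower,
    ← ContinuousLinearMap.integral_comp_comm _ ((continuous_phase l).integrableOn_smul_Ioo hU),
    fourierCoeffOn_eq_integral, intervalIntegral.integral_of_le hab.le,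
    integral_Ioc_eq_integral_Ioo, mul_smul_comm, ← integral_const_mul]
  congr 1
  refine integral_congr_ae (Filter.Eventually.of_forall fun x => ?_)
  have hba : ((b : ℂ) - a) ≠ 0 := by
    rw [← Complex.ofReal_sub]; exact_mod_cast (sub_pos.2 hab).ne'
  simp only [map_smul, smul_eq_mul, EuclideanSpace.coe_proj, fourier_coe_apply, ← mul_assoc,
    ← Complex.exp_add, freq]
  congr 2
  push_cast
  field_simp
  ring

theorem hasSum_sq_norm_coeff (hab : a < b) (f : L2Spinor a b) :
    HasSum (fun l => ‖coeff a b f l‖ ^ 2) ((b - a)⁻¹ * ‖f‖ ^ 2) := by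
  have hm : ∀ j, MemLp (fun x => f x j) 2 (volume.restrict (Ioc a b)) := fun j => by
    rw [Measure.restrict_congr_set Ioo_ae_eq_Ioc.symm]
    exact (EuclideanSpace.proj j : Spinor →L[ℂ] ℂ).comp_memLp' (Lp.memLp f)
  have hint : IntegrableOn f (Ioo a b) := (Lp.memLp f).integrable (by simp)
  have h := (hasSum_sq_fourierCoeffOn hab (hm 0)).add (hasSum_sq_fourierCoeffOn hab (hm 1))
  convert h using 1
  · ext l
    rw [EuclideanSpace.norm_sq_eq, Fin.sum_univ_two, coeff_apply hab hint, coeff_apply hab hint,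
      norm_mul, norm_mul, Complex.norm_exp]
    simp
  · have hsq : ∀ j, IntegrableOn (fun x => ‖f x j‖ ^ 2) (Ioc a b) :=
      fun j => (hm j).norm.integrable_sq
    rw [← smul_add, smul_eq_mul, ← intervalIntegral.integral_add
      ((intervalIntegrable_iff_integrableOn_Ioc_of_le hab.le).2 (hsq 0))
      ((intervalIntegrable_iff_integrableOn_Ioc_of_le hab.le).2 (hsq 1)),
      intervalIntegral.integral_of_le hab.le, integral_Ioc_eq_integral_Ioo]
    congr 1
    have e := congr_arg RCLike.re (L2.inner_def (𝕜 := ℂ) f f)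
    rw [← integral_re (L2.integrable_inner f f)] at e
    simp only [← norm_sq_eq_re_inner] at e
    rw [e]
    simp_rw [EuclideanSpace.norm_sq_eq, Fin.sum_univ_two]

theorem norm_coeff_le (hab : a < b) (f : L2Spinor a b) (l : ℤ) :
    ‖coeff a b f l‖ ≤ Real.sqrt ((b - a)⁻¹) * ‖f‖ := by
  refine le_of_sq_le_sq ?_ (by positivity)
  rw [mul_pow, Real.sq_sqrt (inv_nonneg.2 (sub_pos.2 hab).le)]
  exact le_hasSum (hasSum_sq_norm_coeff hab f) l fun _ _ => by positivity

theorem coeff_Lp_add (f g : L2Spinor a b) (l : ℤ) :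
    coeff a b (f + g : L2Spinor a b) l = coeff a b f l + coeff a b g l := by
  rw [coeff_congr_ae (Lp.coeFn_add f g), coeff_add ((Lp.memLp f).integrable (by simp))
    ((Lp.memLp g).integrable (by simp))]

/-- The Fourier coefficient as a continuous map on `L²`. Linearity over `ℝ` suffices, since it is
applied to derivatives in time. -/
noncomputable def coeffCLM (hab : a < b) (l : ℤ) : L2Spinor a b →L[ℝ] Spinor :=
  LinearMap.mkContinuous
    { toFun := fun f => coeff a b f l
      map_add' := fun f g => coeff_Lp_add f g l
      map_smul' := fun r f => by
        rw [coeff_congr_ae (Lp.coeFn_smul r f), coeff_smul, RingHom.id_apply] }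
    (Real.sqrt ((b - a)⁻¹)) fun f => norm_coeff_le hab f l

@[simp] theorem coeffCLM_apply (hab : a < b) (l : ℤ) (f : L2Spinor a b) :
    coeffCLM hab l f = coeff a b f l := rfl

/-- The frequencies `-M/2, …, M/2 - 1` of `trigPoly`. -/
noncomputable abbrev modes (M : ℕ) : Finset ℤ := Finset.Ico (-((M : ℤ) / 2)) ((M : ℤ) / 2)

/-- Orthogonality of the exponentials. -/
theorem integral_exp_freq (hab : a < b) (k l : ℤ) :
    ∫ x in Ioo a b, Complex.exp (-(Complex.I * (freq a b l : ℂ) * ((x - a : ℝ) : ℂ)))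
      * Complex.exp (Complex.I * (freq a b k : ℂ) * ((x - a : ℝ) : ℂ))
      = if k = l then ((b - a : ℝ) : ℂ) else 0 := by
  have e : ∀ x : ℝ, Complex.exp (-(Complex.I * (freq a b l : ℂ) * ((x - a : ℝ) : ℂ)))
      * Complex.exp (Complex.I * (freq a b k : ℂ) * ((x - a : ℝ) : ℂ))
      = Complex.exp (Complex.I * (freq a b (k - l) : ℂ) * ((x - a : ℝ) : ℂ)) := by
    intro x
    rw [← Complex.exp_add]
    congr 1
    simp only [freq]
    push_cast
    ring
  simp_rw [e]
  rw [← integral_Ioc_eq_integral_Ioo, ← intervalIntegral.integral_of_le hab.le,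
    intervalIntegral.integral_comp_sub_right
      (fun x : ℝ => Complex.exp (Complex.I * (freq a b (k - l) : ℂ) * (x : ℂ)))]
  split_ifs with h
  · simp [h, freq]
  · have hba : ((b : ℂ) - a) ≠ 0 := by
      rw [← Complex.ofReal_sub]; exact_mod_cast (sub_pos.2 hab).ne'
    have hkl : ((k : ℂ) - l) ≠ 0 := by
      rw [← Int.cast_sub]; exact_mod_cast sub_ne_zero.2 h
    have hne : Complex.I * (freq a b (k - l) : ℂ) ≠ 0 := by
      refine mul_ne_zero Complex.I_ne_zero ?_
      simp only [freq]
      push_cast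
      exact div_ne_zero (mul_ne_zero (mul_ne_zero two_ne_zero hkl)
        (by exact_mod_cast Real.pi_ne_zero)) hba
    rw [integral_exp_mul_complex hne]
    have : Complex.I * (freq a b (k - l) : ℂ) * ((b - a : ℝ) : ℂ)
        = ((k - l : ℤ) : ℂ) * (2 * Real.pi * Complex.I) := by
      simp only [freq]
      push_cast
      field_simp
    rw [this, Complex.exp_int_mul_two_pi_mul_I]
    simp

theorem continuous_trigPoly (M : ℕ) (c : ℤ → Spinor) : Continuous (trigPoly a b M c) := by
  unfold trigPoly
  fun_prop

theorem coeff_trigPoly (hab : a < b) (M : ℕ) (c : ℤ → Spinor) (l : ℤ) :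
    coeff a b (trigPoly a b M c) l = if l ∈ modes M then c l else 0 := by
  unfold coeff trigPoly
  simp_rw [Finset.smul_sum, smul_smul]
  rw [integral_finsetSum]
  · simp_rw [integral_smul_const, integral_exp_freq hab, ite_smul, zero_smul]
    rw [Finset.sum_ite_eq']
    split_ifs with h
    · rw [Complex.coe_smul, smul_smul, one_div, inv_mul_cancel₀ (sub_pos.2 hab).ne', one_smul]
    · simp
  · intro k _
    refine (Continuous.integrableOn_Icc ?_).mono_set Ioo_subset_Icc_self
    fun_prop

theorem memLp_trigPoly (M : ℕ) (c : ℤ → Spinor) :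
    MemLp (trigPoly a b M c) 2 (volume.restrict (Ioo a b)) := by
  obtain ⟨B, hB⟩ := (isCompact_Icc (a := a) (b := b)).exists_bound_of_continuousOn
    (continuous_trigPoly (a := a) (b := b) M c).continuousOn
  refine MemLp.of_bound (continuous_trigPoly M c).aestronglyMeasurable B ?_
  exact (ae_restrict_iff' measurableSet_Ioo).2
    (Filter.Eventually.of_forall fun x hx => hB x (Ioo_subset_Icc_self hx))

/-- The trigonometric polynomial `trigPoly` as an element of `L²`. -/
noncomputable def trigL2 (a b : ℝ) (M : ℕ) (c : ℤ → Spinor) : L2Spinor a b :=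
  (memLp_trigPoly (a := a) (b := b) M c).toLp

theorem coeff_trigL2 (hab : a < b) (M : ℕ) (c : ℤ → Spinor) (l : ℤ) :
    coeff a b (trigL2 a b M c) l = if l ∈ modes M then c l else 0 := by
  rw [trigL2, coeff_congr_ae (MemLp.coeFn_toLp _), coeff_trigPoly hab]

theorem sum_sq_norm_coeff_le (hab : a < b) (f : L2Spinor a b) (s : Finset ℤ) :
    ∑ l ∈ s, ‖coeff a b f l‖ ^ 2 ≤ (b - a)⁻¹ * ‖f‖ ^ 2 :=
  sum_le_hasSum s (fun _ _ => by positivity) (hasSum_sq_norm_coeff hab f)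

theorem sq_norm_trigL2 (hab : a < b) (M : ℕ) (c : ℤ → Spinor) :
    (b - a)⁻¹ * ‖trigL2 a b M c‖ ^ 2 = ∑ l ∈ modes M, ‖c l‖ ^ 2 := by
  refine (hasSum_sq_norm_coeff hab _).unique ?_
  have : ∑ l ∈ modes M, ‖c l‖ ^ 2 = ∑ l ∈ modes M, ‖coeff a b (trigL2 a b M c) l‖ ^ 2 :=
    Finset.sum_congr rfl fun l hl => by rw [coeff_trigL2 hab, if_pos hl]
  rw [this]
  exact hasSum_sum_of_ne_finset_zero fun l hl => by rw [coeff_trigL2 hab, if_neg hl]; simp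

theorem trigL2_sub (M : ℕ) (c d : ℤ → Spinor) :
    trigL2 a b M (fun l => c l - d l) = trigL2 a b M c - trigL2 a b M d := by
  rw [trigL2, trigL2, trigL2, ← MemLp.toLp_sub]
  congr 1
  ext1 x
  simp [trigPoly, smul_sub, Finset.sum_sub_distrib]

/-- If outside the retained modes the coefficients of `f` are dominated by those of `g`, then
the projection error of `f` is dominated by the norm of `g`. -/
theorem norm_sub_trigL2_coeff_le (hab : a < b) (M : ℕ) (f g : L2Spinor a b) {κ : ℝ} (hκ : 0 ≤ κ)
    (h : ∀ l ∉ modes M, ‖coeff a b f l‖ ≤ κ * ‖coeff a b g l‖) :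
    ‖f - trigL2 a b M (coeff a b f)‖ ≤ κ * ‖g‖ := by
  refine le_of_sq_le_sq ?_ (by positivity)
  have h1 := hasSum_sq_norm_coeff hab (f - trigL2 a b M (coeff a b f))
  have h2 := (hasSum_sq_norm_coeff hab g).mul_left (κ ^ 2)
  have h3 := hasSum_le (fun l => ?_) h1 h2
  · rw [mul_pow]
    have hba : 0 < (b - a)⁻¹ := inv_pos.2 (sub_pos.2 hab)
    refine le_of_mul_le_mul_left (h3.trans_eq ?_) hba
    ring
  · rw [← coeffCLM_apply hab, map_sub, coeffCLM_apply, coeffCLM_apply, coeff_trigL2 hab]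
    split_ifs with hl
    · rw [sub_self, norm_zero, zero_pow two_ne_zero]; positivity
    · rw [sub_zero, ← mul_pow]
      exact pow_le_pow_left₀ (norm_nonneg _) (h l hl) 2

/-- Spatial differentiation multiplies the coefficients by `iμ_l`. Periodicity of the trace makes
the boundary terms of the integration by parts cancel. -/
theorem coeff_weakDeriv (hab : a < b) {u v : ℝ → Spinor} (h : HasWeakDerivOn a b u v)
    (hu : IntegrableOn u (Ioo a b)) (hv : IntegrableOn v (Ioo a b)) (hp : PeriodicTrace a b u)
    (l : ℤ) : coeff a b v l = (Complex.I * freq a b l) • coeff a b u l := by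
  obtain ⟨c, hc⟩ := h.ae_eq_primitive hab hu hv
  obtain ⟨w, hw, huw, hwab⟩ := hp
  have hvI : IntervalIntegrable v volume a b :=
    (intervalIntegrable_iff_integrableOn_Ioo_of_le hab.le).2 hv
  have hWc : ContinuousOn (fun x => ∫ y in a..x, v y) (Icc a b) := by
    have := intervalIntegral.continuousOn_primitive_interval' hvI left_mem_uIcc
    rwa [uIcc_of_le hab.le] at this
  have hwW := eqOn_Icc_of_ae_eq hab hw (continuousOn_const.add hWc) (huw.symm.trans hc)
  have hzero : ∫ y in a..b, v y = 0 := by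
    have e1 := hwW (left_mem_Icc.2 hab.le)
    have e2 := hwW (right_mem_Icc.2 hab.le)
    simp only [Pi.add_apply, intervalIntegral.integral_same, add_zero] at e1 e2
    rw [hwab, e2] at e1
    exact left_eq_add.1 e1.symm
  set φ : ℝ → ℂ := fun x =>
    Complex.exp (-(Complex.I * (freq a b l : ℂ) * ((x - a : ℝ) : ℂ))) with hφ
  have hd : ∀ x, HasDerivAt φ (-(Complex.I * freq a b l) * φ x) x := by
    intro x
    have h1 : HasDerivAt (fun x : ℝ => ((x - a : ℝ) : ℂ)) 1 x := by
      simpa using ((hasDerivAt_id x).sub_const a).ofReal_comp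
    have h2 := ((h1.const_mul (Complex.I * (freq a b l : ℂ))).fun_neg).cexp
    exact h2.congr_deriv (by rw [mul_one, mul_comm])
  have hφc : Continuous φ := continuous_phase l
  have key := integral_deriv_smul_primitive hab.le hd (continuous_const.mul hφc) hv
  rw [hzero, smul_zero, zero_sub] at key
  have hconst : ∫ x in Ioo a b, φ x • c = (if (0 : ℤ) = l then ((b - a : ℝ) : ℂ) else 0) • c := by
    rw [integral_smul_const, ← integral_exp_freq hab 0 l]
    simp [hφ, freq]
  -- The additive constant of the primitive only contributes to `l = 0`, where `μ_l = 0`.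
  have hfl : (freq a b l : ℂ) * (if (0 : ℤ) = l then ((b - a : ℝ) : ℂ) else 0) = 0 := by
    split_ifs with h0
    · simp [← h0, freq]
    · simp
  have hu' : ∫ x in Ioo a b, φ x • u x
      = (∫ x in Ioo a b, φ x • c) + ∫ x in Ioo a b, φ x • (∫ y in a..x, v y) := by
    rw [← integral_add]
    · refine integral_congr_ae ?_
      filter_upwards [hc] with x hx
      rw [hx, smul_add]
    · exact hφc.integrableOn_smul_Ioo (integrableOn_const (by simp))
    · exact hφc.integrableOn_smul_Ioo (hWc.integrableOn_Icc.mono_set Ioo_subset_Icc_self)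
  simp_rw [mul_smul] at key
  rw [integral_smul] at key
  unfold coeff
  rw [smul_comm _ (1 / (b - a) : ℝ)]
  congr 1
  rw [hu', hconst, smul_add, smul_smul, mul_assoc, hfl, mul_zero, zero_smul, zero_add]
  rw [neg_smul, neg_inj] at key
  exact key.symm

theorem HpNormLE.coeff_deriv (hab : a < b) {m : ℕ} {u : ℝ → Spinor} {R : ℝ}
    (h : HpNormLE a b m u R) (hR : 0 ≤ R) : ∃ g : L2Spinor a b, ‖g‖ ≤ R ∧
      ∀ l, coeff a b g l = (Complex.I * freq a b l) ^ m • coeff a b u l := by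
  obtain ⟨D, hD0, hD, hw, hp, hs⟩ := h
  have hi : ∀ l ≤ m, IntegrableOn (D l) (Ioo a b) := fun l hl => (hD l hl).integrable (by simp)
  refine ⟨(hD m le_rfl).toLp, ?_, fun l => ?_⟩
  · refine le_of_sq_le_sq ?_ hR
    refine le_trans ?_ hs
    have e := congr_arg RCLike.re (L2.inner_def (𝕜 := ℂ) ((hD m le_rfl).toLp) ((hD m le_rfl).toLp))
    rw [← integral_re (L2.integrable_inner _ _)] at e
    simp only [← norm_sq_eq_re_inner] at e
    rw [e]
    refine le_trans (le_of_eq ?_) (Finset.single_le_sum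
      (f := fun l => ∫ x in Ioo a b, ‖D l x‖ ^ 2) (fun l _ => by positivity)
      (Finset.self_mem_range_succ m))
    refine integral_congr_ae ?_
    filter_upwards [(hD m le_rfl).coeFn_toLp] with x hx
    rw [hx]
  · rw [coeff_congr_ae (MemLp.coeFn_toLp _), ← hD0]
    have : ∀ k ≤ m, coeff a b (D k) l = (Complex.I * freq a b l) ^ k • coeff a b (D 0) l := by
      intro k
      induction k with
      | zero => intro _; simp
      | succ k ih =>
        intro hk
        rw [coeff_weakDeriv hab (hw k hk) (hi k (Nat.le_of_succ_le hk)) (hi (k + 1) hk) (hp k hk),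
          ih (Nat.le_of_succ_le hk), smul_smul, pow_succ']
    exact this m le_rfl

/-- A frequency that is cut off satisfies `|μ_l| ≥ π / h ≥ 1 / h`. -/
theorem one_le_mul_abs_freq (hab : a < b) {M : ℕ} (hM : 0 < M) (hMe : Even M) {l : ℤ}
    (hl : l ∉ modes M) : 1 ≤ (b - a) / M * |freq a b l| := by
  have hba := sub_pos.2 hab
  have hM' : (0 : ℝ) < M := by exact_mod_cast hM
  have h2 : (M : ℤ) ≤ 2 * |l| := by
    obtain ⟨k, rfl⟩ := hMe
    rw [Finset.mem_Ico] at hl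
    push_cast at hl ⊢
    rcases abs_cases l with ⟨h, h'⟩ | ⟨h, h'⟩ <;> omega
  have h2' : (M : ℝ) ≤ 2 * |(l : ℝ)| := by exact_mod_cast h2
  have e : (b - a) / M * |freq a b l| = 2 * |(l : ℝ)| / M * Real.pi := by
    rw [freq, abs_div, abs_mul, abs_mul, abs_of_pos hba, abs_of_pos Real.pi_pos, abs_two]
    field_simp
  rw [e]
  have h3 : 1 ≤ 2 * |(l : ℝ)| / M := (one_le_div hM').2 h2'
  nlinarith [Real.pi_gt_three]

theorem norm_sub_trigL2_coeff_le_of_HpNormLE (hab : a < b) {M : ℕ} (hM : 0 < M) (hMe : Even M)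
    {m : ℕ} {f : L2Spinor a b} {R : ℝ} (hR : 0 ≤ R) (h : HpNormLE a b m f R) :
    ‖f - trigL2 a b M (coeff a b f)‖ ≤ ((b - a) / M) ^ m * R := by
  obtain ⟨g, hg, hgl⟩ := h.coeff_deriv hab hR
  have hba := sub_pos.2 hab
  refine (norm_sub_trigL2_coeff_le hab M f g (κ := ((b - a) / M) ^ m) (by positivity)
    fun l hl => ?_).trans (by gcongr)
  rw [hgl, norm_smul, norm_pow, norm_mul, Complex.norm_I, one_mul, Complex.norm_real,
    Real.norm_eq_abs, ← mul_assoc, ← mul_pow]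
  exact le_mul_of_one_le_left (norm_nonneg _) (one_le_pow₀ (one_le_mul_abs_freq hab hM hMe hl))

end Fourier

/-! ### The free propagator and one step of the integrator -/

section Propagator

variable {a b : ℝ}

theorem act_mul (B C : Matrix (Fin 2) (Fin 2) ℂ) (u : Spinor) :
    act (B * C) u = act B (act C u) := by
  simp [act]

theorem act_add (B C : Matrix (Fin 2) (Fin 2) ℂ) (u : Spinor) :
    act (B + C) u = act B u + act C u := by
  simp [act]

theorem act_sub (B C : Matrix (Fin 2) (Fin 2) ℂ) (u : Spinor) :
    act (B - C) u = act B u - act C u := by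
  simp [act]

theorem act_smul (c : ℂ) (B : Matrix (Fin 2) (Fin 2) ℂ) (u : Spinor) :
    act (c • B) u = c • act B u := by
  simp [act]

theorem act_one (u : Spinor) : act 1 u = u := by
  simp [act]

theorem act_vec_sub (B : Matrix (Fin 2) (Fin 2) ℂ) (u w : Spinor) :
    act B (u - w) = act B u - act B w := map_sub _ _ _

theorem act_vec_smul (c : ℂ) (B : Matrix (Fin 2) (Fin 2) ℂ) (u : Spinor) :
    act B (c • u) = c • act B u := map_smul _ _ _

/-- The generator `X_l = -(i/ε²) Γ_l` of the free evolution of the `l`-th mode. -/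
noncomputable def generator (ε a b : ℝ) (l : ℤ) : Matrix (Fin 2) (Fin 2) ℂ :=
  (-(Complex.I / (ε : ℂ) ^ 2)) • Gam ε a b l

theorem expGam_eq (ε a b τ : ℝ) (l : ℤ) :
    expGam ε a b τ l = NormedSpace.exp (τ • generator ε a b l) := by
  rw [expGam, generator, ← Complex.coe_smul, smul_smul]
  congr 2
  ring

theorem expGam_zero (ε a b : ℝ) (l : ℤ) : expGam ε a b 0 l = 1 := by
  simp [expGam_eq, NormedSpace.exp_zero]

theorem isHermitian_Gam (ε a b : ℝ) (l : ℤ) : (Gam ε a b l).conjTranspose = Gam ε a b l := by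
  ext i j
  fin_cases i <;> fin_cases j <;> simp [Gam, pauli1, pauli3]

theorem conjTranspose_exp_mul_exp {X : Matrix (Fin 2) (Fin 2) ℂ} (hX : X.conjTranspose = -X) :
    (NormedSpace.exp X).conjTranspose * NormedSpace.exp X = 1 := by
  rw [← Matrix.exp_conjTranspose, hX,
    ← Matrix.exp_add_of_commute (-X) X (Commute.neg_left (Commute.refl X)), neg_add_cancel,
    NormedSpace.exp_zero]

theorem norm_act_of_conjTranspose_mul {B : Matrix (Fin 2) (Fin 2) ℂ}
    (hB : B.conjTranspose * B = 1) (u : Spinor) : ‖act B u‖ = ‖u‖ := by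
  have h2 : ‖act B u‖ ^ 2 = ‖u‖ ^ 2 := by
    rw [← inner_self_eq_norm_sq (𝕜 := ℂ), ← inner_self_eq_norm_sq (𝕜 := ℂ)]
    congr 1
    rw [act, ← ContinuousLinearMap.adjoint_inner_left, ← ContinuousLinearMap.star_eq_adjoint,
      ← map_star, ← mul_apply_eq_comp, ← map_mul, Matrix.star_eq_conjTranspose, hB,
      map_one, one_apply_eq_self]
  exact (sq_eq_sq₀ (norm_nonneg _) (norm_nonneg _)).1 h2

theorem norm_act_expGam (ε a b τ : ℝ) (l : ℤ) (u : Spinor) :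
    ‖act (expGam ε a b τ l) u‖ = ‖u‖ := by
  have hs : (τ • generator ε a b l).conjTranspose = -(τ • generator ε a b l) := by
    rw [generator, Matrix.conjTranspose_smul,
      Matrix.conjTranspose_smul, isHermitian_Gam]
    simp only [star_trivial, star_neg, star_div₀, RCLike.star_def, Complex.conj_I, map_pow,
      Complex.conj_ofReal, neg_div, neg_neg, neg_smul, smul_neg]
  rw [expGam_eq]
  exact norm_act_of_conjTranspose_mul (conjTranspose_exp_mul_exp hs) u

open scoped Matrix.Norms.L2Operator

/-- The action of matrices on spinors as a continuous bilinear map over `ℝ`, for the product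
rule. -/
noncomputable def actL : Matrix (Fin 2) (Fin 2) ℂ →L[ℝ] Spinor →L[ℝ] Spinor :=
  (ContinuousLinearMap.restrictScalarsL ℂ Spinor Spinor ℝ ℝ).comp
    (LinearMap.toContinuousLinearMap
      ((Matrix.toEuclideanCLM (n := Fin 2) (𝕜 := ℂ)).toAlgEquiv.toLinearMap.restrictScalars ℝ))

theorem actL_apply (B : Matrix (Fin 2) (Fin 2) ℂ) (u : Spinor) : actL B u = act B u := rfl

theorem hasDerivWithinAt_act {B : ℝ → Matrix (Fin 2) (Fin 2) ℂ} {B' : Matrix (Fin 2) (Fin 2) ℂ}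
    {u : ℝ → Spinor} {u' : Spinor} {s : Set ℝ} {t : ℝ} (hB : HasDerivWithinAt B B' s t)
    (hu : HasDerivWithinAt u u' s t) :
    HasDerivWithinAt (fun t => act (B t) (u t)) (act (B t) u' + act B' (u t)) s t := by
  have h := actL.hasDerivWithinAt_of_bilinear hB hu
  simpa only [actL_apply] using h

theorem hasDerivAt_expGam (ε a b τ : ℝ) (l : ℤ) :
    HasDerivAt (fun τ => expGam ε a b τ l) (generator ε a b l * expGam ε a b τ l) τ := by
  simp_rw [expGam_eq]
  exact hasDerivAt_exp_smul_const' (𝕂 := ℝ) (generator ε a b l) τ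

theorem commute_expGam (ε a b τ : ℝ) (l : ℤ) :
    expGam ε a b τ l * generator ε a b l = generator ε a b l * expGam ε a b τ l := by
  rw [expGam_eq]
  exact (((Commute.refl (generator ε a b l)).smul_left τ).exp_left).eq

theorem isUnit_det_Gam (ε a b : ℝ) (l : ℤ) : IsUnit (Gam ε a b l).det := by
  have : (Gam ε a b l).det = -((1 + (freq a b l * ε) ^ 2 : ℝ) : ℂ) := by
    simp [Gam, pauli1, pauli3, Matrix.det_fin_two]
    ring
  rw [this, isUnit_iff_ne_zero, neg_ne_zero, Complex.ofReal_ne_zero]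
  positivity

theorem smul_inv_Gam_mul_generator_mul {ε : ℝ} (hε : 0 < ε) (a b : ℝ) (l : ℤ)
    (B : Matrix (Fin 2) (Fin 2) ℂ) :
    (-(Complex.I * (ε : ℂ) ^ 2)) • ((Gam ε a b l)⁻¹ * (generator ε a b l * B)) = -B := by
  have hε' : (ε : ℂ) ≠ 0 := by exact_mod_cast hε.ne'
  have e : -(Complex.I * (ε : ℂ) ^ 2) * -(Complex.I / (ε : ℂ) ^ 2) = -1 := by
    field_simp; simp
  rw [generator, smul_mul_assoc, mul_smul_comm, smul_smul, e, ← mul_assoc,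
    Matrix.nonsing_inv_mul _ (isUnit_det_Gam ε a b l), one_mul, neg_one_smul]

theorem generator_mul_smul_inv_Gam_mul {ε : ℝ} (hε : 0 < ε) (a b : ℝ) (l : ℤ)
    (B : Matrix (Fin 2) (Fin 2) ℂ) :
    generator ε a b l * ((-(Complex.I * (ε : ℂ) ^ 2)) • ((Gam ε a b l)⁻¹ * B)) = -B := by
  have hε' : (ε : ℂ) ≠ 0 := by exact_mod_cast hε.ne'
  have e : -(Complex.I * (ε : ℂ) ^ 2) * -(Complex.I / (ε : ℂ) ^ 2) = -1 := by
    field_simp; simp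
  rw [generator, smul_mul_assoc, mul_smul_comm, smul_smul, mul_comm, e, ← mul_assoc,
    Matrix.mul_nonsing_inv _ (isUnit_det_Gam ε a b l), one_mul, neg_one_smul]

/-- `Q^{(1)}` solves `Q' = X Q + 1`, being `∫_0^τ e^{sX} ds`. -/
theorem hasDerivAt_Q1 {ε : ℝ} (hε : 0 < ε) (a b τ : ℝ) (l : ℤ) :
    HasDerivAt (fun τ => Q1 ε a b τ l) (generator ε a b l * Q1 ε a b τ l + 1) τ := by
  have h := (((hasDerivAt_expGam ε a b τ l).const_sub 1).const_mul (Gam ε a b l)⁻¹).const_smul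
    (-(Complex.I * (ε : ℂ) ^ 2))
  refine h.congr_deriv ?_
  rw [Q1, generator_mul_smul_inv_Gam_mul hε, mul_neg, smul_neg,
    smul_inv_Gam_mul_generator_mul hε]
  abel

theorem Q2_eq (ε a b τ : ℝ) (l : ℤ) :
    Q2 ε a b τ l
      = (-(Complex.I * (ε : ℂ) ^ 2)) • ((Gam ε a b l)⁻¹ * (τ • 1 - Q1 ε a b τ l)) := by
  rw [Q2, Q1]
  generalize 1 - expGam ε a b τ l = P
  rw [mul_sub, smul_sub, sub_eq_add_neg, mul_smul_comm, mul_smul_comm, smul_smul, mul_one,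
    ← neg_smul, ← mul_assoc, pow_two (Gam ε a b l)⁻¹, ← Complex.coe_smul, smul_smul]
  congr 2
  · ring
  · linear_combination (ε : ℂ) ^ 4 * Complex.I_sq

/-- `Q^{(2)}` solves `Q' = X Q + τ`, being `∫_0^τ s e^{(τ-s)X} ds`. -/
theorem hasDerivAt_Q2 {ε : ℝ} (hε : 0 < ε) (a b τ : ℝ) (l : ℤ) :
    HasDerivAt (fun τ => Q2 ε a b τ l) (generator ε a b l * Q2 ε a b τ l + τ • 1) τ := by
  simp_rw [Q2_eq]
  have h0 : HasDerivAt (fun τ : ℝ => τ • (1 : Matrix (Fin 2) (Fin 2) ℂ)) ((1 : ℝ) • 1) τ :=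
    (hasDerivAt_id τ).smul_const _
  have h := ((h0.sub (hasDerivAt_Q1 hε a b τ l)).const_mul (Gam ε a b l)⁻¹).const_smul
    (-(Complex.I * (ε : ℂ) ^ 2))
  refine h.congr_deriv ?_
  rw [generator_mul_smul_inv_Gam_mul hε, one_smul, sub_add_cancel_right, mul_neg, smul_neg,
    smul_inv_Gam_mul_generator_mul hε]
  abel

theorem Q1_zero (ε a b : ℝ) (l : ℤ) : Q1 ε a b 0 l = 0 := by
  simp [Q1, expGam_zero]

theorem Q2_zero (ε a b : ℝ) (l : ℤ) : Q2 ε a b 0 l = 0 := by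
  simp [Q2, expGam_zero]

/-- One step of length `τ` of the exponential wave integrator in the `l`-th mode, from the
coefficient `c`, where `f` and `δ` are the coefficients of the force and of its difference
quotient. -/
noncomputable def ewiCoeff (ε a b τ : ℝ) (l : ℤ) (c f δ : Spinor) : Spinor :=
  act (expGam ε a b τ l) c - Complex.I • act (Q1 ε a b τ l) f - Complex.I • act (Q2 ε a b τ l) δ

theorem ewiCoeff_zero (ε a b : ℝ) (l : ℤ) (c f δ : Spinor) : ewiCoeff ε a b 0 l c f δ = c := by
  simp [ewiCoeff, expGam_zero, Q1_zero, Q2_zero, act]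

/-- As a function of the step length, the update solves the mode equation with the affine
force `f + τ δ`. -/
theorem hasDerivAt_ewiCoeff {ε : ℝ} (hε : 0 < ε) (a b τ : ℝ) (l : ℤ) (c f δ : Spinor) :
    HasDerivAt (fun τ => ewiCoeff ε a b τ l c f δ)
      (act (generator ε a b l) (ewiCoeff ε a b τ l c f δ) - Complex.I • (f + τ • δ)) τ := by
  have hact : ∀ {B : ℝ → Matrix (Fin 2) (Fin 2) ℂ} {B' : Matrix (Fin 2) (Fin 2) ℂ} (u : Spinor),
      HasDerivAt B B' τ → HasDerivAt (fun t => act (B t) u) (act B' u) τ := by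
    intro B B' u hB
    have h := hasDerivWithinAt_act hB.hasDerivWithinAt (hasDerivWithinAt_const τ univ u)
    rw [hasDerivWithinAt_univ] at h
    simpa [act] using h
  have h := ((hact c (hasDerivAt_expGam ε a b τ l)).sub
    ((hact f (hasDerivAt_Q1 hε a b τ l)).const_smul Complex.I)).sub
    ((hact δ (hasDerivAt_Q2 hε a b τ l)).const_smul Complex.I)
  refine h.congr_deriv ?_
  rw [ewiCoeff, act_vec_sub, act_vec_sub, act_vec_smul, act_vec_smul, act_add, act_add, act_mul,
    act_mul, act_mul, act_one, ← Complex.coe_smul τ, act_smul, act_one, Complex.coe_smul]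
  module

/-- Energy estimate for finitely many modes: `e^{-tX_l} d_l(t)` has derivative
`-i e^{-tX_l} R_l(t)`, and `e^{-tX_l}` is unitary, so the mean value inequality applies in the
Hilbert sum of the modes. -/
theorem sqrt_sum_sq_norm_le_of_hasDerivWithinAt {ε a b τ ρ : ℝ} (hτ : 0 ≤ τ) (s : Finset ℤ)
    {d R : ℤ → ℝ → Spinor}
    (hd : ∀ l ∈ s, ∀ t ∈ Icc 0 τ, HasDerivWithinAt (d l)
      (act (generator ε a b l) (d l t) - Complex.I • R l t) (Icc 0 τ) t)
    (hR : ∀ t ∈ Icc 0 τ, √(∑ l ∈ s, ‖R l t‖ ^ 2) ≤ ρ) :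
    √(∑ l ∈ s, ‖d l τ‖ ^ 2) ≤ √(∑ l ∈ s, ‖d l 0‖ ^ 2) + ρ * τ := by
  let y : ℝ → PiLp 2 (fun _ : s => Spinor) := fun t =>
    WithLp.toLp 2 fun l => act (expGam ε a b (-t) l) (d l t)
  let y' : ℝ → PiLp 2 (fun _ : s => Spinor) := fun t =>
    WithLp.toLp 2 fun l => -(Complex.I • act (expGam ε a b (-t) l) (R l t))
  have hy : ∀ t ∈ Icc 0 τ, HasDerivWithinAt y (y' t) (Icc 0 τ) t := by
    intro t ht
    have hcomp : HasDerivWithinAt (fun t (l : s) => act (expGam ε a b (-t) l) (d l t))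
        (fun l : s => -(Complex.I • act (expGam ε a b (-t) l) (R l t))) (Icc 0 τ) t := by
      refine hasDerivWithinAt_pi.2 fun l => ?_
      have hE : HasDerivAt (fun t : ℝ => expGam ε a b (-t) (l : ℤ))
          ((-1 : ℝ) • (generator ε a b l * expGam ε a b (-t) l)) t :=
        (hasDerivAt_expGam ε a b (-t) l).scomp t (hasDerivAt_neg t)
      have h := hasDerivWithinAt_act hE.hasDerivWithinAt (hd l l.2 t ht)
      refine h.congr_deriv ?_
      have e : ∀ (B : Matrix (Fin 2) (Fin 2) ℂ) u, act ((-1 : ℝ) • B) u = -act B u := by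
        intro B u
        rw [neg_one_smul]
        simp [act]
      rw [e, act_vec_sub, act_vec_smul, ← act_mul, commute_expGam]
      abel
    exact (PiLp.continuousLinearEquiv 2 ℝ
      (fun _ : s => Spinor)).symm.toContinuousLinearMap.hasFDerivAt.comp_hasDerivWithinAt t hcomp
  have hn : ∀ t, ‖y t‖ = √(∑ l ∈ s, ‖d l t‖ ^ 2) := by
    intro t
    rw [PiLp.norm_eq_of_L2, ← Finset.sum_coe_sort s]
    simp_rw [y, norm_act_expGam]
  have hn' : ∀ t, ‖y' t‖ = √(∑ l ∈ s, ‖R l t‖ ^ 2) := by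
    intro t
    rw [PiLp.norm_eq_of_L2, ← Finset.sum_coe_sort s]
    simp_rw [y', norm_neg, norm_smul, Complex.norm_I, one_mul, norm_act_expGam]
  have h := norm_image_sub_le_of_norm_deriv_le_segment' hy
    (fun t ht => (hn' t).trans_le (hR t (Ico_subset_Icc_self ht))) τ (right_mem_Icc.2 hτ)
  rw [sub_zero] at h
  rw [← hn, ← hn]
  linarith [norm_le_norm_add_norm_sub' (y τ) (y 0)]

theorem norm_trigL2 (hab : a < b) (M : ℕ) (c : ℤ → Spinor) :
    ‖trigL2 a b M c‖ = √(b - a) * √(∑ l ∈ modes M, ‖c l‖ ^ 2) := by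
  have hba := sub_pos.2 hab
  rw [← sq_norm_trigL2 hab, ← Real.sqrt_mul hba.le, ← mul_assoc, mul_inv_cancel₀ hba.ne', one_mul,
    Real.sqrt_sq (norm_nonneg _)]

/-- Local error of one step: if the exact solution `U` is driven by `F`, and the scheme replaces
`F` by an affine function of time at distance at most `ρ`, the error grows by at most `ρ τ`. -/
theorem norm_trigL2_sub_ewiCoeff_le {ε τ ρ : ℝ} (hab : a < b) (hε : 0 < ε) (hτ : 0 ≤ τ) (M : ℕ)
    {U F : ℝ → L2Spinor a b} {c f δ : L2Spinor a b}
    (hU : ∀ l, ∀ t ∈ Icc 0 τ, HasDerivWithinAt (fun t => coeff a b (U t) l)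
      (act (generator ε a b l) (coeff a b (U t) l) - Complex.I • coeff a b (F t) l) (Icc 0 τ) t)
    (hF : ∀ t ∈ Icc 0 τ, ‖F t - (f + t • δ)‖ ≤ ρ) :
    ‖trigL2 a b M (coeff a b (U τ))
        - trigL2 a b M (fun l => ewiCoeff ε a b τ l (coeff a b c l) (coeff a b f l)
            (coeff a b δ l))‖
      ≤ ‖trigL2 a b M (coeff a b (U 0)) - trigL2 a b M (coeff a b c)‖ + ρ * τ := by
  have hba := sub_pos.2 hab
  rw [← trigL2_sub, ← trigL2_sub, norm_trigL2 hab, norm_trigL2 hab]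
  have h := sqrt_sum_sq_norm_le_of_hasDerivWithinAt (ε := ε) (a := a) (b := b)
    (ρ := (√(b - a))⁻¹ * ρ) hτ (modes M)
    (d := fun l t => coeff a b (U t) l
      - ewiCoeff ε a b t l (coeff a b c l) (coeff a b f l) (coeff a b δ l))
    (R := fun l t => coeff a b (F t - (f + t • δ) : L2Spinor a b) l)
    (fun l _ t ht => ?_) (fun t ht => ?_)
  · simp only [ewiCoeff_zero] at h
    refine (mul_le_mul_of_nonneg_left h (Real.sqrt_nonneg _)).trans_eq ?_
    have : √(b - a) ≠ 0 := (Real.sqrt_pos.2 hba).ne'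
    field_simp
  · refine ((hU l t ht).sub (hasDerivAt_ewiCoeff hε a b t l _ _ _).hasDerivWithinAt).congr_deriv ?_
    simp only [← coeffCLM_apply hab, map_sub, map_add, map_smul, act_vec_sub]
    module
  · refine (Real.sqrt_le_sqrt (sum_sq_norm_coeff_le hab _ _)).trans ?_
    rw [Real.sqrt_mul (inv_nonneg.2 hba.le), Real.sqrt_inv, Real.sqrt_sq (norm_nonneg _)]
    gcongr
    exact hF t ht

end Propagator

/-! ### Calculus of `C^{1,1}` functions of time -/

section TimeRegularity

variable {E F G : Type*} [NormedAddCommGroup E] [NormedSpace ℝ E] [NormedAddCommGroup F]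
  [NormedSpace ℝ F] [NormedAddCommGroup G] [NormedSpace ℝ G] {T : ℝ}

theorem IsC11On.norm_sub_le_mul {u v : ℝ → E} {K₀ K₁ K₂ : ℝ} (h : IsC11On T u v K₀ K₁ K₂)
    {s t : ℝ} (hs : s ∈ Icc 0 T) (ht : t ∈ Icc 0 T) : ‖u t - u s‖ ≤ K₁ * |t - s| :=
  (convex_Icc 0 T).norm_image_sub_le_of_norm_hasDerivWithin_le h.hasDeriv h.bound₁ hs ht

/-- Taylor's formula of first order, without the optimal factor `1/2`. -/
theorem IsC11On.norm_taylor_le {u v : ℝ → E} {K₀ K₁ K₂ : ℝ} (h : IsC11On T u v K₀ K₁ K₂)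
    (hK₂ : 0 ≤ K₂) {s t : ℝ} (hs : s ∈ Icc 0 T) (ht : t ∈ Icc 0 T) :
    ‖u t - u s - (t - s) • v s‖ ≤ K₂ * (t - s) ^ 2 := by
  have hsub : uIcc s t ⊆ Icc 0 T := by
    intro x hx
    exact ⟨(le_min hs.1 ht.1).trans hx.1, hx.2.trans (max_le hs.2 ht.2)⟩
  have key := (convex_uIcc s t).norm_image_sub_le_of_norm_hasDerivWithin_le
    (f := fun x => u x - x • v s) (f' := fun x => v x - (1 : ℝ) • v s) (C := K₂ * |t - s|)
    (fun x hx => ((h.hasDeriv x (hsub hx)).mono hsub).sub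
      ((hasDerivAt_id x).smul_const _).hasDerivWithinAt)
    (fun x hx => by
      rw [one_smul]
      refine (h.lipschitz s hs x (hsub hx)).trans ?_
      gcongr K₂ * ?_
      exact abs_sub_left_of_mem_uIcc hx)
    left_mem_uIcc right_mem_uIcc
  rw [Real.norm_eq_abs, mul_assoc, ← sq, sq_abs] at key
  convert key using 2
  module

theorem IsC11On.comp_clm {u v : ℝ → E} {K₀ K₁ K₂ : ℝ} (h : IsC11On T u v K₀ K₁ K₂)
    (L : E →L[ℝ] F) (hL : ∀ x, ‖L x‖ ≤ ‖x‖) :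
    IsC11On T (fun t => L (u t)) (fun t => L (v t)) K₀ K₁ K₂ where
  hasDeriv t ht := L.hasFDerivAt.comp_hasDerivWithinAt t (h.hasDeriv t ht)
  bound₀ t ht := (hL _).trans (h.bound₀ t ht)
  bound₁ t ht := (hL _).trans (h.bound₁ t ht)
  lipschitz s hs t ht := by
    rw [← map_sub]
    exact (hL _).trans (h.lipschitz s hs t ht)

theorem IsC11On.sub {u v u' v' : ℝ → E} {K₀ K₁ K₂ K₀' K₁' K₂' : ℝ}
    (h : IsC11On T u v K₀ K₁ K₂) (h' : IsC11On T u' v' K₀' K₁' K₂') :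
    IsC11On T (fun t => u t - u' t) (fun t => v t - v' t) (K₀ + K₀') (K₁ + K₁') (K₂ + K₂') where
  hasDeriv t ht := (h.hasDeriv t ht).sub (h'.hasDeriv t ht)
  bound₀ t ht := (norm_sub_le _ _).trans (add_le_add (h.bound₀ t ht) (h'.bound₀ t ht))
  bound₁ t ht := (norm_sub_le _ _).trans (add_le_add (h.bound₁ t ht) (h'.bound₁ t ht))
  lipschitz s hs t ht := by
    rw [sub_sub_sub_comm, add_mul]
    exact (norm_sub_le _ _).trans (add_le_add (h.lipschitz s hs t ht) (h'.lipschitz s hs t ht))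

theorem IsC11On.bilin (hT : 0 ≤ T) (B : E →L[ℝ] F →L[ℝ] G) (hB : ∀ x y, ‖B x y‖ ≤ ‖x‖ * ‖y‖)
    {u u' : ℝ → E} {w w' : ℝ → F} {K₀ K₁ K₂ L₀ L₁ L₂ : ℝ}
    (hu : IsC11On T u u' K₀ K₁ K₂) (hw : IsC11On T w w' L₀ L₁ L₂) :
    IsC11On T (fun t => B (u t) (w t)) (fun t => B (u t) (w' t) + B (u' t) (w t))
      (K₀ * L₀) (K₀ * L₁ + K₁ * L₀) (K₀ * L₂ + 2 * (K₁ * L₁) + K₂ * L₀) := by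
  have h0 := left_mem_Icc.2 hT
  have hK₀ : 0 ≤ K₀ := (norm_nonneg _).trans (hu.bound₀ 0 h0)
  have hK₁ : 0 ≤ K₁ := (norm_nonneg _).trans (hu.bound₁ 0 h0)
  have hL₀ : 0 ≤ L₀ := (norm_nonneg _).trans (hw.bound₀ 0 h0)
  have hL₁ : 0 ≤ L₁ := (norm_nonneg _).trans (hw.bound₁ 0 h0)
  have hBle : ∀ {x y p q}, ‖x‖ ≤ p → ‖y‖ ≤ q → 0 ≤ p → ‖B x y‖ ≤ p * q := fun hx hy hp =>
    (hB _ _).trans (mul_le_mul hx hy (norm_nonneg _) hp)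
  refine ⟨fun t ht => B.hasDerivWithinAt_of_bilinear (hu.hasDeriv t ht) (hw.hasDeriv t ht),
    fun t ht => hBle (hu.bound₀ t ht) (hw.bound₀ t ht) hK₀,
    fun t ht => (norm_add_le _ _).trans (add_le_add (hBle (hu.bound₀ t ht) (hw.bound₁ t ht) hK₀)
      (hBle (hu.bound₁ t ht) (hw.bound₀ t ht) hK₁)), fun s hs t ht => ?_⟩
  have e : B (u t) (w' t) + B (u' t) (w t) - (B (u s) (w' s) + B (u' s) (w s))
      = (B (u t) (w' t - w' s) + B (u t - u s) (w' s))
        + (B (u' t) (w t - w s) + B (u' t - u' s) (w s)) := by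
    simp only [map_sub, sub_apply]
    abel
  have hK₂ : 0 ≤ K₂ * |t - s| := (norm_nonneg _).trans (hu.lipschitz s hs t ht)
  rw [e]
  refine (norm_add_le _ _).trans ((add_le_add
    ((norm_add_le _ _).trans (add_le_add
      (hBle (hu.bound₀ t ht) (hw.lipschitz s hs t ht) hK₀)
      (hBle (hu.norm_sub_le_mul hs ht) (hw.bound₁ s hs) (by positivity))))
    ((norm_add_le _ _).trans (add_le_add
      (hBle (hu.bound₁ t ht) (hw.norm_sub_le_mul hs ht) hK₁)
      (hBle (hu.lipschitz s hs t ht) (hw.bound₀ s hs) hK₂)))).trans_eq ?_)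
  ring

end TimeRegularity

/-! ### The force term `G Φ` -/

section Force

variable {a b : ℝ}

/-- The product of an `L^∞` function and an `L²` spinor, as a continuous bilinear map. -/
noncomputable def smulL (a b : ℝ) : LInfReal a b →L[ℝ] L2Spinor a b →L[ℝ] L2Spinor a b :=
  LinearMap.mkContinuous₂
    (LinearMap.mk₂ ℝ (fun (v : LInfReal a b) (u : L2Spinor a b) => (v • u : L2Spinor a b))
      (fun v w u => Lp.smul_add v w u) (fun c v u => Lp.smul_assoc c v u)
      (fun v u w => Lp.add_smul v u w) (fun c v u => (Lp.smul_comm c v u).symm))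
    1 fun v u => by rw [one_mul]; exact Lp.norm_smul_le v u

theorem smulL_apply (v : LInfReal a b) (u : L2Spinor a b) :
    smulL a b v u = (v • u : L2Spinor a b) := rfl

theorem norm_smulL_le (v : LInfReal a b) (u : L2Spinor a b) : ‖smulL a b v u‖ ≤ ‖v‖ * ‖u‖ :=
  Lp.norm_smul_le v u

/-- Pointwise multiplication by `σ₁` on `L²`. -/
noncomputable def pauli1L (a b : ℝ) : L2Spinor a b →L[ℝ] L2Spinor a b :=
  ((Matrix.toEuclideanCLM (n := Fin 2) (𝕜 := ℂ) pauli1).restrictScalars ℝ).compLpL 2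
    (volume.restrict (Ioo a b))

theorem coeFn_pauli1L (u : L2Spinor a b) :
    pauli1L a b u =ᵐ[volume.restrict (Ioo a b)] fun x => act pauli1 (u x) :=
  ContinuousLinearMap.coeFn_compLp _ _

theorem norm_pauli1L_le (u : L2Spinor a b) : ‖pauli1L a b u‖ ≤ ‖u‖ := by
  refine Lp.norm_le_norm_of_ae_le ?_
  filter_upwards [coeFn_pauli1L u] with x hx
  rw [hx, norm_act_of_conjTranspose_mul]
  ext i j
  fin_cases i <;> fin_cases j <;> simp [pauli1, Matrix.mul_apply]

/-- The force `G u = v u - α σ₁ u` for potentials `v`, `α` in `L^∞`. -/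
noncomputable def force (v α : LInfReal a b) (u : L2Spinor a b) : L2Spinor a b :=
  smulL a b v u - smulL a b α (pauli1L a b u)

theorem coeFn_force (v α : LInfReal a b) (u : L2Spinor a b) :
    force v α u =ᵐ[volume.restrict (Ioo a b)] fun x => act (potential (v x) (α x)) (u x) := by
  filter_upwards [Lp.coeFn_sub (smulL a b v u) (smulL a b α (pauli1L a b u)),
    Lp.coeFn_lpSMul (r := 2) v u, Lp.coeFn_lpSMul (r := 2) α (pauli1L a b u), coeFn_pauli1L u]
    with x h1 h2 h3 h4
  rw [force, h1, Pi.sub_apply, smulL_apply, smulL_apply, h2, h3, Pi.smul_apply', Pi.smul_apply',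
    h4, potential, act_sub, act_smul, act_smul, act_one, Complex.coe_smul, Complex.coe_smul]

theorem force_sub (v α : LInfReal a b) (u w : L2Spinor a b) :
    force v α (u - w) = force v α u - force v α w := by
  simp only [force, map_sub]
  abel

theorem norm_force_le (v α : LInfReal a b) (u : L2Spinor a b) :
    ‖force v α u‖ ≤ (‖v‖ + ‖α‖) * ‖u‖ := by
  rw [add_mul]
  refine (norm_sub_le _ _).trans (add_le_add (norm_smulL_le _ _) ((norm_smulL_le _ _).trans ?_))
  gcongr
  exact norm_pauli1L_le u

theorem IsC11On.force {T : ℝ} (hT : 0 ≤ T) {V V' A A' : ℝ → LInfReal a b}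
    {u u' : ℝ → L2Spinor a b} {K₀ K₁ K₂ L₀ L₁ L₂ : ℝ} (hV : IsC11On T V V' K₀ K₁ K₂)
    (hA : IsC11On T A A' K₀ K₁ K₂) (hu : IsC11On T u u' L₀ L₁ L₂) :
    ∃ f' : ℝ → L2Spinor a b, IsC11On T (fun t => DiracEWI.force (V t) (A t) (u t)) f'
      (2 * (K₀ * L₀)) (2 * (K₀ * L₁ + K₁ * L₀)) (2 * (K₀ * L₂ + 2 * (K₁ * L₁) + K₂ * L₀)) := by
  have h := (hV.bilin hT (smulL a b) norm_smulL_le hu).sub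
    (hA.bilin hT (smulL a b) norm_smulL_le (hu.comp_clm (pauli1L a b) norm_pauli1L_le))
  simp only [← two_mul] at h
  exact ⟨_, h⟩

end Force

/-! ### The equation for the Fourier modes -/

section Modes

variable {ε a b T : ℝ}

/-- The Dirac equation in the `l`-th mode, for almost every time. -/
theorem IsDiracSolution.coeff_deriv_eq (hab : a < b) (hε : 0 < ε) {V A : ℝ → LInfReal a b}
    {Φ₀ : L2Spinor a b} {Φ Φt : ℝ → L2Spinor a b}
    (h : IsDiracSolution ε a b T V A Φ₀ Φ Φt) (l : ℤ) :
    ∀ᵐ t ∂(volume.restrict (Ioo 0 T)), coeff a b (Φt t) l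
      = act (generator ε a b l) (coeff a b (Φ t) l)
        - Complex.I • coeff a b (force (V t) (A t) (Φ t)) l := by
  have hε' : (ε : ℂ) ≠ 0 := by exact_mod_cast hε.ne'
  have hint : ∀ f : L2Spinor a b, IntegrableOn f (Ioo a b) := fun f =>
    (Lp.memLp f).integrable (by simp)
  have hB : ∀ (B : Matrix (Fin 2) (Fin 2) ℂ) {u : ℝ → Spinor}, IntegrableOn u (Ioo a b) →
      IntegrableOn (fun x => act B (u x)) (Ioo a b) := fun B u hu =>
    ContinuousLinearMap.integrable_comp (Matrix.toEuclideanCLM (n := Fin 2) (𝕜 := ℂ) B) hu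
  filter_upwards [h.equation] with t ht
  obtain ⟨Φx, hΦx, hw, hp, -, heq⟩ := ht
  have hΦxi : IntegrableOn Φx (Ioo a b) := hΦx.integrable (by simp)
  have e : (fun x => act (Complex.I • 1) (Φt t x)) =ᵐ[volume.restrict (Ioo a b)]
      ((fun x => act ((-(Complex.I / (ε : ℂ))) • pauli1) (Φx x))
        + fun x => act ((1 / (ε : ℂ) ^ 2) • pauli3) (Φ t x))
        + fun x => force (V t) (A t) (Φ t) x := by
    filter_upwards [heq, coeFn_force (V t) (A t) (Φ t)] with x h1 h2
    simp only [Pi.add_apply]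
    rw [act_smul, act_one, act_smul, act_smul, h1, h2]
  have key := coeff_congr_ae e l
  rw [coeff_add ((hB _ hΦxi).add (hB _ (hint _))) (hint _), coeff_add (hB _ hΦxi) (hB _ (hint _)),
    coeff_act (hint _), coeff_act hΦxi, coeff_act (hint _),
    coeff_weakDeriv hab hw (hint _) hΦxi hp, act_smul, act_one, act_smul, act_smul,
    act_vec_smul] at key
  have hI : ∀ u : Spinor, u = (-Complex.I) • Complex.I • u := fun u => by
    rw [smul_smul]; simp
  rw [hI (coeff a b (Φt t) l), key, generator, Gam, act_smul, act_add, act_smul]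
  simp only [smul_add, smul_smul, neg_smul, sub_eq_add_neg]
  congr 2
  · congr 1
    have e3 : -Complex.I * (-(Complex.I / (ε : ℂ)) * (Complex.I * (freq a b l : ℂ)))
        = (Complex.I * Complex.I) * (Complex.I * freq a b l / ε) := by ring
    rw [e3, Complex.I_mul_I]
    push_cast
    field_simp
  · rw [← neg_smul]
    congr 1
    ring

/-- The Dirac equation in the `l`-th mode holds classically, at every time in `[0,T]`, because
both sides of the almost everywhere identity are continuous. -/
theorem IsDiracSolution.hasDerivWithinAt_coeff (hab : a < b) (hε : 0 < ε) (hT : 0 < T)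
    {V A : ℝ → LInfReal a b} {Φ₀ : L2Spinor a b} {Φ Φt Φ' : ℝ → L2Spinor a b}
    (h : IsDiracSolution ε a b T V A Φ₀ Φ Φt) {K₀ K₁ K₂ : ℝ} (hΦ : IsC11On T Φ Φ' K₀ K₁ K₂)
    (hae : Φt =ᵐ[volume.restrict (Ioo 0 T)] Φ')
    (hF : ContinuousOn (fun t => force (V t) (A t) (Φ t)) (Icc 0 T)) (l : ℤ) :
    ∀ t ∈ Icc 0 T, HasDerivWithinAt (fun t => coeff a b (Φ t) l)
      (act (generator ε a b l) (coeff a b (Φ t) l)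
        - Complex.I • coeff a b (force (V t) (A t) (Φ t)) l) (Icc 0 T) t := by
  have hΦc : ContinuousOn Φ (Icc 0 T) := fun t ht => (hΦ.hasDeriv t ht).continuousWithinAt
  have hΦ'c : ContinuousOn Φ' (Icc 0 T) := by
    refine (LipschitzOnWith.of_dist_le_mul (K := K₂.toNNReal) fun s hs t ht => ?_).continuousOn
    rw [dist_eq_norm, Real.dist_eq]
    refine (hΦ.lipschitz t ht s hs).trans ?_
    gcongr
    exact Real.le_coe_toNNReal K₂
  have heq : EqOn (fun t => coeff a b (Φ' t) l)
      (fun t => act (generator ε a b l) (coeff a b (Φ t) l)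
        - Complex.I • coeff a b (force (V t) (A t) (Φ t)) l) (Icc 0 T) := by
    simp only [← coeffCLM_apply hab]
    refine eqOn_Icc_of_ae_eq hT ((coeffCLM hab l).continuous.comp_continuousOn hΦ'c) ?_ ?_
    · exact ((Matrix.toEuclideanCLM (n := Fin 2) (𝕜 := ℂ) (generator ε a b
        l)).continuous.comp_continuousOn
        ((coeffCLM hab l).continuous.comp_continuousOn hΦc)).sub
        (((coeffCLM hab l).continuous.comp_continuousOn hF).const_smul Complex.I)
    · filter_upwards [hae, h.coeff_deriv_eq hab hε l] with t h1 h2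
      rw [← h1]
      exact h2
  intro t ht
  refine HasDerivWithinAt.congr_deriv ?_ (heq ht)
  exact (coeffCLM hab l).hasFDerivAt.comp_hasDerivWithinAt t (hΦ.hasDeriv t ht)

end Modes

/-! ### The scheme as a recursion in `L²` -/

section Scheme

variable {a b : ℝ}

theorem trigL2_coeff_trigL2 (hab : a < b) (M : ℕ) (c : ℤ → Spinor) :
    trigL2 a b M (coeff a b (trigL2 a b M c)) = trigL2 a b M c := by
  rw [← sub_eq_zero, ← trigL2_sub, ← norm_eq_zero, norm_trigL2 hab, Finset.sum_eq_zero,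
    Real.sqrt_zero, mul_zero]
  intro l hl
  rw [coeff_trigL2 hab, if_pos hl, sub_self, norm_zero, zero_pow two_ne_zero]

theorem norm_trigL2_coeff_le (hab : a < b) (M : ℕ) (f : L2Spinor a b) :
    ‖trigL2 a b M (coeff a b f)‖ ≤ ‖f‖ := by
  have hba := sub_pos.2 hab
  rw [norm_trigL2 hab, ← Real.sqrt_mul hba.le]
  refine Real.sqrt_le_iff.2 ⟨norm_nonneg _, ?_⟩
  refine (mul_le_mul_of_nonneg_left (sum_sq_norm_coeff_le hab f (modes M)) hba.le).trans_eq ?_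
  rw [← mul_assoc, mul_inv_cancel₀ hba.ne', one_mul]

theorem continuous_trigL2_coeff (hab : a < b) (M : ℕ) :
    Continuous fun f : L2Spinor a b => trigL2 a b M (coeff a b f) := by
  refine (LipschitzWith.of_dist_le_mul (K := 1) fun f g => ?_).continuous
  have e : (fun l => coeff a b f l - coeff a b g l) = coeff a b (f - g : L2Spinor a b) := by
    ext1 l
    simp only [← coeffCLM_apply hab, map_sub]
  rw [dist_eq_norm, dist_eq_norm, NNReal.coe_one, one_mul, ← trigL2_sub, e]
  exact norm_trigL2_coeff_le hab M _

variable (ε τ : ℝ) (M : ℕ) (V A : ℝ → LInfReal a b) (Φ₀ : L2Spinor a b)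

theorem memLp_ewiFS (n : ℕ) :
    MemLp (ewiFS ε a b τ M (fun t x => V t x) (fun t x => A t x) Φ₀ n) 2
      (volume.restrict (Ioo a b)) := by
  rcases n with _ | _ | n <;> simp only [ewiFS] <;> exact memLp_trigPoly M _

/-- The numerical solution as an element of `L²`. -/
noncomputable def ewiL2 (n : ℕ) : L2Spinor a b := (memLp_ewiFS ε τ M V A Φ₀ n).toLp

theorem coeff_ewiFS (n : ℕ) (l : ℤ) :
    coeff a b (ewiFS ε a b τ M (fun t x => V t x) (fun t x => A t x) Φ₀ n) l
      = coeff a b (ewiL2 ε τ M V A Φ₀ n) l :=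
  coeff_congr_ae (MemLp.coeFn_toLp _).symm l

theorem forceCoeff_ewiFS (t : ℝ) (n : ℕ) (l : ℤ) :
    forceCoeff a b (fun t x => V t x) (fun t x => A t x) t
        (ewiFS ε a b τ M (fun t x => V t x) (fun t x => A t x) Φ₀ n) l
      = coeff a b (force (V t) (A t) (ewiL2 ε τ M V A Φ₀ n)) l := by
  refine coeff_congr_ae ?_ l
  filter_upwards [coeFn_force (V t) (A t) (ewiL2 ε τ M V A Φ₀ n),
    (memLp_ewiFS ε τ M V A Φ₀ n).coeFn_toLp] with x h1 h2
  rw [h1, ewiL2, h2]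

theorem ewiL2_eq_trigL2 {n : ℕ} {c : ℤ → Spinor}
    (h : ewiFS ε a b τ M (fun t x => V t x) (fun t x => A t x) Φ₀ n = trigPoly a b M c) :
    ewiL2 ε τ M V A Φ₀ n = trigL2 a b M c := by
  unfold ewiL2 trigL2
  congr 1

theorem ewiL2_zero : ewiL2 ε τ M V A Φ₀ 0 = trigL2 a b M (coeff a b Φ₀) :=
  ewiL2_eq_trigL2 ε τ M V A Φ₀ (by rw [ewiFS])

theorem ewiL2_one (hab : a < b) : ewiL2 ε τ M V A Φ₀ 1 = trigL2 a b M fun l =>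
    ewiCoeff ε a b τ l (coeff a b (ewiL2 ε τ M V A Φ₀ 0) l)
      (coeff a b (force (V 0) (A 0) (ewiL2 ε τ M V A Φ₀ 0)) l)
      (coeff a b (0 : L2Spinor a b) l) := by
  refine ewiL2_eq_trigL2 ε τ M V A Φ₀ ?_
  rw [ewiFS]
  congr 1
  ext1 l
  rw [coeff_ewiFS, forceCoeff_ewiFS, ← coeffCLM_apply hab l 0, map_zero, ewiCoeff]
  simp [act]

theorem ewiL2_add_two (hab : a < b) (n : ℕ) :
    ewiL2 ε τ M V A Φ₀ (n + 2) = trigL2 a b M fun l =>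
      ewiCoeff ε a b τ l (coeff a b (ewiL2 ε τ M V A Φ₀ (n + 1)) l)
        (coeff a b (force (V (((n + 1 : ℕ) : ℝ) * τ)) (A (((n + 1 : ℕ) : ℝ) * τ))
          (ewiL2 ε τ M V A Φ₀ (n + 1))) l)
        (coeff a b ((1 / τ : ℝ) • (force (V (((n + 1 : ℕ) : ℝ) * τ)) (A (((n + 1 : ℕ) : ℝ) * τ))
            (ewiL2 ε τ M V A Φ₀ (n + 1))
          - force (V ((n : ℝ) * τ)) (A ((n : ℝ) * τ)) (ewiL2 ε τ M V A Φ₀ n)) :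
            L2Spinor a b) l) := by
  refine ewiL2_eq_trigL2 ε τ M V A Φ₀ ?_
  rw [ewiFS]
  congr 1
  ext1 l
  rw [coeff_ewiFS, forceCoeff_ewiFS, forceCoeff_ewiFS, ewiCoeff]
  simp only [← coeffCLM_apply hab, map_sub, map_smul]

theorem trigL2_coeff_ewiL2 (hab : a < b) (n : ℕ) :
    trigL2 a b M (coeff a b (ewiL2 ε τ M V A Φ₀ n)) = ewiL2 ε τ M V A Φ₀ n := by
  rcases n with _ | _ | n
  · rw [ewiL2_zero, trigL2_coeff_trigL2 hab]
  · rw [ewiL2_one _ _ _ _ _ _ hab, trigL2_coeff_trigL2 hab]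
  · rw [ewiL2_add_two _ _ _ _ _ _ hab, trigL2_coeff_trigL2 hab]

end Scheme

/-! ### Error recursion and convergence -/

/-- A discrete Gronwall inequality for errors that depend on the two preceding time levels. The
error `r₀` of the first step is not proportional to `τ`, but occurs only once. -/
theorem two_step_gronwall {e : ℕ → ℝ} {τ T κ r₀ r : ℝ} (hτ : 0 < τ) (hκ : 0 ≤ κ)
    (hr₀ : 0 ≤ r₀) (hr : 0 ≤ r) (he : e 0 = 0)
    (h1 : τ ≤ T → e 1 ≤ r₀ + r * τ)
    (h2 : ∀ n : ℕ, ((n + 2 : ℕ) : ℝ) * τ ≤ T →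
      e (n + 2) ≤ e (n + 1) + (κ * (e (n + 1) + e n) + r) * τ)
    (n : ℕ) (hn : (n : ℝ) * τ ≤ T) : e n ≤ (r₀ + r * T) * Real.exp (2 * κ * T) := by
  set q := 1 + 2 * κ * τ with hq
  have hq1 : 1 ≤ q := by
    have : 0 ≤ 2 * κ * τ := by positivity
    linarith
  have hb : ∀ n : ℕ, (n : ℝ) * τ ≤ T → e n ≤ (r₀ + r * (n * τ)) * q ^ n := by
    intro n
    induction n using Nat.strong_induction_on with
    | _ n ih =>
      intro hn
      rcases n with _ | _ | n
      · simpa [he] using hr₀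
      · have := h1 (by simpa using hn)
        refine this.trans ?_
        have h0 : 0 ≤ r₀ + r * τ := by positivity
        simpa using le_mul_of_one_le_right h0 hq1
      · have hn1 : ((n + 1 : ℕ) : ℝ) * τ ≤ T := by
          refine le_trans ?_ hn
          gcongr
          omega
        have hn0 : (n : ℝ) * τ ≤ T := by
          refine le_trans ?_ hn1
          gcongr
          omega
        set B := (r₀ + r * ((n + 1 : ℕ) * τ)) * q ^ (n + 1) with hB
        have e1 : e (n + 1) ≤ B := ih (n + 1) (by omega) hn1
        have e0 : e n ≤ B := by
          refine (ih n (by omega) hn0).trans ?_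
          rw [hB]
          gcongr <;> omega
        -- The bound is increasing in `n`, so both preceding errors are at most `B`.
        have hqn : 1 ≤ q ^ (n + 1) * q := by
          rw [← pow_succ]
          exact one_le_pow₀ hq1
        have e2 : r * τ ≤ r * τ * (q ^ (n + 1) * q) :=
          le_mul_of_one_le_right (by positivity) hqn
        calc e (n + 2) ≤ e (n + 1) + (κ * (e (n + 1) + e n) + r) * τ := h2 n hn
          _ ≤ B + (κ * (B + B) + r) * τ := by gcongr
          _ = B * q + r * τ := by rw [hq]; ring
          _ ≤ B * q + r * τ * (q ^ (n + 1) * q) := by gcongr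
          _ = _ := by rw [hB, pow_succ q (n + 1)]; push_cast; ring
  have hT : 0 ≤ T := le_trans (by positivity) hn
  refine (hb n hn).trans ?_
  have hqe : q ^ n ≤ Real.exp (2 * κ * T) := by
    have : q ≤ Real.exp (2 * κ * τ) := by
      rw [hq, add_comm]
      exact Real.add_one_le_exp _
    refine (pow_le_pow_left₀ (by linarith) this n).trans ?_
    rw [← Real.exp_nat_mul]
    refine Real.exp_le_exp.2 ?_
    calc (n : ℝ) * (2 * κ * τ) = 2 * κ * (n * τ) := by ring
      _ ≤ 2 * κ * T := by gcongr
  gcongr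

/-- Linear extrapolation from `r` and `r + τ` to `r + τ + s` has an error of second order: both
`u (r + τ + s)` and `u r` are expanded at `r + τ`. -/
theorem norm_sub_extrapolation_le {E : Type*} [NormedAddCommGroup E] [NormedSpace ℝ E]
    {T : ℝ} {u v : ℝ → E} {K₀ K₁ K₂ : ℝ} (h : IsC11On T u v K₀ K₁ K₂) (hK₂ : 0 ≤ K₂) {r τ s : ℝ}
    (hr : 0 ≤ r) (hs : s ∈ Icc 0 τ) (hτ : 0 < τ) (hT : r + τ + τ ≤ T) :
    ‖u (r + τ + s) - (u (r + τ) + s • (1 / τ : ℝ) • (u (r + τ) - u r))‖ ≤ 2 * K₂ * τ ^ 2 := by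
  have hm : r + τ ∈ Icc 0 T := ⟨by linarith, by linarith⟩
  have h1 := h.norm_taylor_le hK₂ hm (t := r + τ + s) ⟨by linarith [hs.1], by linarith [hs.2]⟩
  have h2 := h.norm_taylor_le hK₂ hm (t := r) ⟨hr, by linarith⟩
  have hq0 : 0 ≤ s / τ := div_nonneg hs.1 hτ.le
  have hq1 : s / τ ≤ 1 := (div_le_one hτ).2 hs.2
  have e : u (r + τ + s) - (u (r + τ) + s • (1 / τ : ℝ) • (u (r + τ) - u r))
      = (u (r + τ + s) - u (r + τ) - (r + τ + s - (r + τ)) • v (r + τ))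
        + (s / τ) • (u r - u (r + τ) - (r - (r + τ)) • v (r + τ)) := by
    have hsv : s • v (r + τ) = (s / τ) • τ • v (r + τ) := by
      rw [smul_smul, div_mul_cancel₀ s hτ.ne']
    rw [smul_smul, mul_one_div, add_sub_cancel_left, sub_add_cancel_left, hsv]
    module
  rw [e]
  refine (norm_add_le _ _).trans ?_
  rw [norm_smul, Real.norm_of_nonneg hq0]
  have h3 : K₂ * (r + τ + s - (r + τ)) ^ 2 ≤ K₂ * τ ^ 2 := by
    rw [add_sub_cancel_left]
    gcongr
    exacts [hs.1, hs.2]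
  have h4 : K₂ * (r - (r + τ)) ^ 2 = K₂ * τ ^ 2 := by ring
  rw [h4] at h2
  have h5 := mul_le_mul hq1 h2 (norm_nonneg _) zero_le_one
  linarith

section Convergence

variable {a b T K ε τ : ℝ} {M : ℕ} {V A : ℝ → LInfReal a b} {Φ₀ : L2Spinor a b}
  {Φ Ft : ℝ → L2Spinor a b} {L₀ L₁ L₂ δ : ℝ}

theorem hasDerivWithinAt_coeff_shift {r : ℝ} (hr : 0 ≤ r) (hrT : r + τ ≤ T)
    (hODE : ∀ l, ∀ t ∈ Icc 0 T, HasDerivWithinAt (fun t => coeff a b (Φ t) l)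
      (act (generator ε a b l) (coeff a b (Φ t) l)
        - Complex.I • coeff a b (force (V t) (A t) (Φ t)) l) (Icc 0 T) t) (l : ℤ) :
    ∀ t ∈ Icc 0 τ, HasDerivWithinAt (fun t => coeff a b (Φ (r + t)) l)
      (act (generator ε a b l) (coeff a b (Φ (r + t)) l)
        - Complex.I • coeff a b (force (V (r + t)) (A (r + t)) (Φ (r + t))) l) (Icc 0 τ) t := by
  intro t ht
  have hmaps : MapsTo (fun t => r + t) (Icc 0 τ) (Icc 0 T) := fun s hs =>
    ⟨by linarith [hs.1], by linarith [hs.2]⟩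
  have h := (hODE l (r + t) (hmaps ht)).scomp t
    ((hasDerivAt_id t).const_add r).hasDerivWithinAt hmaps
  simpa [Function.comp_def] using h

theorem norm_force_sub_force_le (hV : ∀ t ∈ Icc 0 T, ‖V t‖ ≤ K) (hA : ∀ t ∈ Icc 0 T, ‖A t‖ ≤ K)
    {t : ℝ} (ht : t ∈ Icc 0 T) (u w : L2Spinor a b) :
    ‖force (V t) (A t) u - force (V t) (A t) w‖ ≤ 2 * K * ‖u - w‖ := by
  rw [← force_sub]
  refine (norm_force_le _ _ _).trans ?_
  gcongr
  linarith [hV t ht, hA t ht]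

/-- Error after the first step, where the force is extrapolated by a constant. -/
theorem norm_sub_ewiL2_one_le (hab : a < b) (hε : 0 < ε) (hτ : 0 < τ) (hτT : τ ≤ T)
    (hV : ∀ t ∈ Icc 0 T, ‖V t‖ ≤ K) (hA : ∀ t ∈ Icc 0 T, ‖A t‖ ≤ K)
    (hODE : ∀ l, ∀ t ∈ Icc 0 T, HasDerivWithinAt (fun t => coeff a b (Φ t) l)
      (act (generator ε a b l) (coeff a b (Φ t) l)
        - Complex.I • coeff a b (force (V t) (A t) (Φ t)) l) (Icc 0 T) t)
    (hF : IsC11On T (fun t => force (V t) (A t) (Φ t)) Ft L₀ L₁ L₂)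
    (hinit : Φ 0 = Φ₀)
    (hproj : ‖Φ 0 - trigL2 a b M (coeff a b (Φ 0))‖ ≤ δ) :
    ‖trigL2 a b M (coeff a b (Φ τ)) - ewiL2 ε τ M V A Φ₀ 1‖ ≤ (L₁ * τ + 2 * K * δ) * τ := by
  have h0T : (0 : ℝ) ∈ Icc 0 T := ⟨le_rfl, hτ.le.trans hτT⟩
  have hK : 0 ≤ K := (norm_nonneg _).trans (hV 0 h0T)
  have hL₁ : 0 ≤ L₁ := (norm_nonneg _).trans (hF.bound₁ 0 h0T)
  have hz : ewiL2 ε τ M V A Φ₀ 0 = trigL2 a b M (coeff a b (Φ 0)) := by rw [ewiL2_zero, hinit]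
  have key := norm_trigL2_sub_ewiCoeff_le (U := fun t => Φ (0 + t))
    (F := fun t => force (V (0 + t)) (A (0 + t)) (Φ (0 + t)))
    (c := ewiL2 ε τ M V A Φ₀ 0) (f := force (V 0) (A 0) (ewiL2 ε τ M V A Φ₀ 0)) (δ := 0)
    (ρ := L₁ * τ + 2 * K * δ) hab hε hτ.le M
    (hasDerivWithinAt_coeff_shift le_rfl (by simpa using hτT) hODE) (fun t ht => ?_)
  · rw [← ewiL2_one _ _ _ _ _ _ hab, trigL2_coeff_ewiL2 _ _ _ _ _ _ hab, hz] at key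
    simpa using key
  · have e : force (V (0 + t)) (A (0 + t)) (Φ (0 + t))
        - (force (V 0) (A 0) (ewiL2 ε τ M V A Φ₀ 0) + t • (0 : L2Spinor a b))
        = (force (V t) (A t) (Φ t) - force (V 0) (A 0) (Φ 0))
          + (force (V 0) (A 0) (Φ 0) - force (V 0) (A 0) (ewiL2 ε τ M V A Φ₀ 0)) := by
      rw [zero_add, smul_zero]
      abel
    rw [e]
    refine (norm_add_le _ _).trans (add_le_add ?_ ?_)
    · refine (hF.norm_sub_le_mul h0T ⟨ht.1, ht.2.trans hτT⟩).trans ?_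
      rw [sub_zero, abs_of_nonneg ht.1]
      gcongr
      exact ht.2
    · refine (norm_force_sub_force_le hV hA h0T _ _).trans ?_
      rw [hz]
      gcongr

/-- Error recursion for the later steps, where the force is extrapolated linearly. -/
theorem norm_sub_ewiL2_add_two_le (hab : a < b) (hε : 0 < ε) (hτ : 0 < τ) (n : ℕ)
    (hnT : ((n + 2 : ℕ) : ℝ) * τ ≤ T)
    (hV : ∀ t ∈ Icc 0 T, ‖V t‖ ≤ K) (hA : ∀ t ∈ Icc 0 T, ‖A t‖ ≤ K)
    (hODE : ∀ l, ∀ t ∈ Icc 0 T, HasDerivWithinAt (fun t => coeff a b (Φ t) l)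
      (act (generator ε a b l) (coeff a b (Φ t) l)
        - Complex.I • coeff a b (force (V t) (A t) (Φ t)) l) (Icc 0 T) t)
    (hF : IsC11On T (fun t => force (V t) (A t) (Φ t)) Ft L₀ L₁ L₂) (hL₂ : 0 ≤ L₂)
    {E₁ E₀ : ℝ} (hE₁ : ‖Φ ((n + 1 : ℕ) * τ) - ewiL2 ε τ M V A Φ₀ (n + 1)‖ ≤ E₁)
    (hE₀ : ‖Φ (n * τ) - ewiL2 ε τ M V A Φ₀ n‖ ≤ E₀) :
    ‖trigL2 a b M (coeff a b (Φ ((n + 2 : ℕ) * τ))) - ewiL2 ε τ M V A Φ₀ (n + 2)‖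
      ≤ ‖trigL2 a b M (coeff a b (Φ ((n + 1 : ℕ) * τ))) - ewiL2 ε τ M V A Φ₀ (n + 1)‖
        + (2 * L₂ * τ ^ 2 + 4 * K * E₁ + 2 * K * E₀) * τ := by
  have e1 : ((n + 1 : ℕ) : ℝ) * τ = n * τ + τ := by push_cast; ring
  have e2 : ((n + 2 : ℕ) : ℝ) * τ = n * τ + τ + τ := by push_cast; ring
  rw [e2] at hnT ⊢
  have hr : 0 ≤ (n : ℝ) * τ := by positivity
  set r := (n : ℝ) * τ with hrdef
  have hrT : r ∈ Icc 0 T := ⟨hr, by linarith⟩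
  have hr1T : r + τ ∈ Icc 0 T := ⟨by linarith, by linarith⟩
  have hK : 0 ≤ K := (norm_nonneg _).trans (hV r hrT)
  have hrec := ewiL2_add_two ε τ M V A Φ₀ hab n
  rw [e1, ← hrdef] at hrec
  rw [e1] at hE₁ ⊢
  set ψ₁ := ewiL2 ε τ M V A Φ₀ (n + 1)
  set ψ₀ := ewiL2 ε τ M V A Φ₀ n
  have key := norm_trigL2_sub_ewiCoeff_le (U := fun t => Φ (r + τ + t))
    (F := fun t => force (V (r + τ + t)) (A (r + τ + t)) (Φ (r + τ + t)))
    (c := ψ₁) (f := force (V (r + τ)) (A (r + τ)) ψ₁)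
    (δ := (1 / τ : ℝ) • (force (V (r + τ)) (A (r + τ)) ψ₁ - force (V r) (A r) ψ₀))
    (ρ := 2 * L₂ * τ ^ 2 + 4 * K * E₁ + 2 * K * E₀) hab hε hτ.le M
    (hasDerivWithinAt_coeff_shift (by linarith) hnT hODE) (fun s hs => ?_)
  · rw [← hrec, trigL2_coeff_ewiL2 _ _ _ _ _ _ hab, add_zero] at key
    exact key
  · have hq0 : 0 ≤ s / τ := div_nonneg hs.1 hτ.le
    have hq1 : s / τ ≤ 1 := (div_le_one hτ).2 hs.2
    have h1 := norm_sub_extrapolation_le hF hL₂ hr hs hτ hnT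
    have h2 := (norm_force_sub_force_le hV hA hr1T (Φ (r + τ)) ψ₁).trans
      (mul_le_mul_of_nonneg_left hE₁ (by positivity))
    have h3 := (norm_force_sub_force_le hV hA hrT (Φ r) ψ₀).trans
      (mul_le_mul_of_nonneg_left hE₀ (by positivity))
    set F₁ := force (V (r + τ)) (A (r + τ)) (Φ (r + τ))
    set F₀ := force (V r) (A r) (Φ r)
    set f₁ := force (V (r + τ)) (A (r + τ)) ψ₁
    set f₀ := force (V r) (A r) ψ₀
    have e : force (V (r + τ + s)) (A (r + τ + s)) (Φ (r + τ + s))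
          - (f₁ + s • (1 / τ : ℝ) • (f₁ - f₀))
        = (force (V (r + τ + s)) (A (r + τ + s)) (Φ (r + τ + s))
            - (F₁ + s • (1 / τ : ℝ) • (F₁ - F₀)))
          + (F₁ - f₁) + (s / τ) • (F₁ - f₁) - (s / τ) • (F₀ - f₀) := by
      rw [smul_smul, smul_smul, mul_one_div]
      module
    have h4 : ‖(s / τ) • (F₁ - f₁)‖ ≤ 2 * K * E₁ := by
      rw [norm_smul, Real.norm_of_nonneg hq0]
      exact (mul_le_of_le_one_left (norm_nonneg _) hq1).trans h2
    have h5 : ‖(s / τ) • (F₀ - f₀)‖ ≤ 2 * K * E₀ := by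
      rw [norm_smul, Real.norm_of_nonneg hq0]
      exact (mul_le_of_le_one_left (norm_nonneg _) hq1).trans h3
    rw [e]
    calc _ ≤ _ := norm_sub_le _ _
      _ ≤ _ := add_le_add_left (norm_add₃_le) _
      _ ≤ 2 * L₂ * τ ^ 2 + 4 * K * E₁ + 2 * K * E₀ := by linarith

/-- Convergence for a force of class `C^{1,1}` and a projection error of at most `δ`. -/
theorem norm_sub_ewiL2_le (hab : a < b) (hε : 0 < ε) (hτ : 0 < τ)
    (hV : ∀ t ∈ Icc 0 T, ‖V t‖ ≤ K) (hA : ∀ t ∈ Icc 0 T, ‖A t‖ ≤ K)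
    (hODE : ∀ l, ∀ t ∈ Icc 0 T, HasDerivWithinAt (fun t => coeff a b (Φ t) l)
      (act (generator ε a b l) (coeff a b (Φ t) l)
        - Complex.I • coeff a b (force (V t) (A t) (Φ t)) l) (Icc 0 T) t)
    (hF : IsC11On T (fun t => force (V t) (A t) (Φ t)) Ft L₀ L₁ L₂) (hL₂ : 0 ≤ L₂)
    (hinit : Φ 0 = Φ₀)
    (hproj : ∀ t ∈ Icc 0 T, ‖Φ t - trigL2 a b M (coeff a b (Φ t))‖ ≤ δ)
    (n : ℕ) (hn : (n : ℝ) * τ ≤ T) :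
    ‖Φ (n * τ) - ewiL2 ε τ M V A Φ₀ n‖
      ≤ δ + (L₁ * τ ^ 2 + (2 * L₂ * τ ^ 2 + 6 * K * δ) * T) * Real.exp (8 * K * T) := by
  have hmem : ∀ n : ℕ, (n : ℝ) * τ ≤ T → (n : ℝ) * τ ∈ Icc 0 T := fun n hn =>
    ⟨by positivity, hn⟩
  have h0T : (0 : ℝ) ∈ Icc 0 T := ⟨le_rfl, (hmem n hn).1.trans (hmem n hn).2⟩
  have hK : 0 ≤ K := (norm_nonneg _).trans (hV 0 h0T)
  have hL₁ : 0 ≤ L₁ := (norm_nonneg _).trans (hF.bound₁ 0 h0T)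
  have hδ : 0 ≤ δ := (norm_nonneg _).trans (hproj 0 h0T)
  set e : ℕ → ℝ := fun n => ‖trigL2 a b M (coeff a b (Φ (n * τ))) - ewiL2 ε τ M V A Φ₀ n‖ with he
  have hE : ∀ n : ℕ, (n : ℝ) * τ ≤ T → ‖Φ (n * τ) - ewiL2 ε τ M V A Φ₀ n‖ ≤ δ + e n :=
    fun n hn => (norm_sub_le_norm_sub_add_norm_sub _ _ _).trans
      (add_le_add_left (hproj _ (hmem n hn)) _)
  refine (hE n hn).trans (add_le_add_right ?_ δ)
  have hg := two_step_gronwall (e := e) (τ := τ) (T := T) (κ := 4 * K) (r₀ := L₁ * τ ^ 2)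
    (r := 2 * L₂ * τ ^ 2 + 6 * K * δ) hτ (by positivity) (by positivity) (by positivity)
    ?_ ?_ ?_ n hn
  · refine hg.trans_eq ?_
    ring_nf
  · simp [he, ewiL2_zero, hinit]
  · intro hτT
    have h := norm_sub_ewiL2_one_le hab hε hτ hτT hV hA hODE hF hinit (hproj 0 h0T)
    have e1 : e 1 = ‖trigL2 a b M (coeff a b (Φ τ)) - ewiL2 ε τ M V A Φ₀ 1‖ := by simp [he]
    rw [e1]
    refine h.trans ?_
    have h1 : 0 ≤ 2 * L₂ * τ ^ 2 * τ := by positivity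
    have h2 : 0 ≤ 4 * K * δ * τ := by positivity
    linarith
  · intro n hn
    have hn1 : ((n + 1 : ℕ) : ℝ) * τ ≤ T := by
      refine le_trans ?_ hn
      gcongr
      omega
    have hn0 : (n : ℝ) * τ ≤ T := by
      refine le_trans ?_ hn1
      gcongr
      omega
    have h := norm_sub_ewiL2_add_two_le hab hε hτ n hn hV hA hODE hF hL₂ (hE _ hn1) (hE _ hn0)
    refine h.trans ?_
    have h1 : 0 ≤ 2 * K * e n * τ := by
      have : 0 ≤ e n := norm_nonneg _
      positivity
    have e2 : ‖trigL2 a b M (coeff a b (Φ ((n + 1 : ℕ) * τ))) - ewiL2 ε τ M V A Φ₀ (n + 1)‖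
        = e (n + 1) := rfl
    rw [e2]
    linarith

end Convergence

end DiracEWI

theorem theorem3p1 (a b T K : ℝ) (hab : a < b) (hT : 0 < T) (m₀ : ℕ) (hm₀ : 2 ≤ m₀) :
    ∃ h₀ : ℝ, 0 < h₀ ∧ ∃ τ₀ : ℝ, 0 < τ₀ ∧ ∃ C : ℝ, 0 < C ∧
      ∀ ε : ℝ, 0 < ε → ε ≤ 1 →
      ∀ (V V₁ V₂ A A₁ A₂ : ℝ → DiracEWI.LInfReal a b)
        (Φ₀ : DiracEWI.L2Spinor a b) (Φ Φt Φtt : ℝ → DiracEWI.L2Spinor a b),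
        DiracEWI.IsDiracSolution ε a b T V A Φ₀ Φ Φt →
        (∀ᵐ t ∂(volume.restrict (Ioo 0 T)), DiracEWI.HpNormLE a b m₀ (Φ t) K) →
        DiracEWI.W2InfBound T Φ Φt Φtt K (K / ε ^ 2) (K / ε ^ 4) →
        DiracEWI.W2InfBound T V V₁ V₂ K K K →
        DiracEWI.W2InfBound T A A₁ A₂ K K K →
      ∀ (M : ℕ) (h τ : ℝ), 0 < M → Even M → h = (b - a) / M → h ≤ h₀ → 0 < τ → τ ≤ τ₀ →
        τ * (DiracEWI.maxNorm T V + DiracEWI.maxNorm T A) ≤ 1 →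
      ∀ n : ℕ, (n : ℝ) * τ ≤ T →
        eLpNorm (fun x => Φ ((n : ℝ) * τ) x
            - DiracEWI.ewiFS ε a b τ M (fun t x => V t x) (fun t x => A t x) Φ₀ n x)
          2 (volume.restrict (Ioo a b))
          ≤ ENNReal.ofReal (C * (τ ^ 2 / ε ^ 4 + h ^ m₀)) := by
  refine ⟨1, one_pos, 1, one_pos,
    1 + |K| + (4 + 22 * T) * K ^ 2 * Real.exp (8 * |K| * T), by positivity, ?_⟩
  intro ε hε hε1 V V₁ V₂ A A₁ A₂ Φ₀ Φ Φt Φtt hsol hreg hΦ hV hA M h τ hM hMe hh _ hτ _ _ n hn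
  obtain ⟨Φ', hΦ', hae⟩ := hΦ.exists_isC11On hT
  obtain ⟨V', hV', -⟩ := hV.exists_isC11On hT
  obtain ⟨A', hA', -⟩ := hA.exists_isC11On hT
  have h0T : (0 : ℝ) ∈ Icc 0 T := ⟨le_rfl, hT.le⟩
  have hK : 0 ≤ K := (norm_nonneg _).trans (hV'.bound₀ 0 h0T)
  have hh0 : 0 ≤ h := by
    rw [hh]
    exact div_nonneg (sub_pos.2 hab).le (Nat.cast_nonneg M)
  obtain ⟨F', hF'⟩ := DiracEWI.IsC11On.force hT.le hV' hA' hΦ'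
  have hODE := hsol.hasDerivWithinAt_coeff hab hε hT hΦ' hae
    fun t ht => (hF'.hasDeriv t ht).continuousWithinAt
  have hproj : ∀ t ∈ Icc 0 T,
      ‖Φ t - DiracEWI.trigL2 a b M (DiracEWI.coeff a b (Φ t))‖ ≤ h ^ m₀ * K := by
    refine DiracEWI.le_on_Icc_of_ae_le hT (hΦ.continuousOn.sub
      ((DiracEWI.continuous_trigL2_coeff hab M).comp_continuousOn hΦ.continuousOn)).norm ?_
    filter_upwards [hreg] with t ht
    rw [hh]
    exact DiracEWI.norm_sub_trigL2_coeff_le_of_HpNormLE hab hM hMe hK ht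
  have main := DiracEWI.norm_sub_ewiL2_le hab hε hτ hV'.bound₀ hA'.bound₀ hODE hF' (by positivity)
    hsol.initial hproj n hn
  have hnorm : eLpNorm (fun x => Φ ((n : ℝ) * τ) x
      - DiracEWI.ewiFS ε a b τ M (fun t x => V t x) (fun t x => A t x) Φ₀ n x)
      2 (volume.restrict (Ioo a b))
      = ENNReal.ofReal ‖Φ (n * τ) - DiracEWI.ewiL2 ε τ M V A Φ₀ n‖ := by
    rw [Lp.norm_def, ENNReal.ofReal_toReal (Lp.eLpNorm_ne_top _)]
    refine eLpNorm_congr_ae ?_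
    filter_upwards [Lp.coeFn_sub (Φ (n * τ)) (DiracEWI.ewiL2 ε τ M V A Φ₀ n),
      (DiracEWI.memLp_ewiFS ε τ M V A Φ₀ n).coeFn_toLp] with x h1 h2
    rw [h1, Pi.sub_apply, DiracEWI.ewiL2, h2]
  rw [hnorm]
  refine ENNReal.ofReal_le_ofReal (main.trans ?_)
  -- Since `ε ≤ 1`, every power of `1 / ε` that occurs is at most `1 / ε ^ 4`
  have hε2 : K / ε ^ 2 ≤ K / ε ^ 4 :=
    div_le_div_of_nonneg_left hK (by positivity) (pow_le_pow_of_le_one hε.le hε1 (by norm_num))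
  have hε0 : K ≤ K / ε ^ 4 := le_div_self hK (by positivity) (pow_le_one₀ hε.le hε1)
  set S := τ ^ 2 / ε ^ 4 with hS
  have hS0 : 0 ≤ S := by positivity
  have hH0 : 0 ≤ h ^ m₀ := pow_nonneg hh0 _
  have hL1 : 2 * (K * (K / ε ^ 2) + K * K) * τ ^ 2 ≤ 4 * K ^ 2 * S := by
    calc _ ≤ 2 * (K * (K / ε ^ 4) + K * (K / ε ^ 4)) * τ ^ 2 := by gcongr
      _ = _ := by rw [hS]; ring
  have hL2 : 2 * (2 * (K * (K / ε ^ 4) + 2 * (K * (K / ε ^ 2)) + K * K)) * τ ^ 2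
      ≤ 16 * K ^ 2 * S := by
    calc _ ≤ 2 * (2 * (K * (K / ε ^ 4) + 2 * (K * (K / ε ^ 4)) + K * (K / ε ^ 4))) * τ ^ 2 := by
          gcongr
      _ = _ := by rw [hS]; ring
  rw [abs_of_nonneg hK]
  set X := Real.exp (8 * K * T)
  have hX : 0 < X := Real.exp_pos _
  calc _ ≤ h ^ m₀ * K + (4 * K ^ 2 * S + (16 * K ^ 2 * S + 6 * K * (h ^ m₀ * K)) * T) * X := by
        gcongr
    _ ≤ (1 + K) * (S + h ^ m₀) + (4 + 22 * T) * K ^ 2 * X * (S + h ^ m₀) := by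
        refine add_le_add ?_ ?_
        · have : 0 ≤ K * S := by positivity
          linarith
        · have h1 : 0 ≤ 6 * T * K ^ 2 * X * S := by positivity
          have h2 : 0 ≤ (4 + 16 * T) * K ^ 2 * X * h ^ m₀ := by positivity
          linarith
    _ = _ := by ring
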